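/- Let $\alpha,\alpha',\beta,\beta',\gamma,\rho,c\in\mathbb{C}$ and $x>0$, with $\operatorname{Re}\gamma>0$ and $$\operatorname{Re}\rho<\min\{\operatorname{Re}(-\beta),\ \operatorname{Re}(\alpha+\alpha'-\gamma),\ \operatorname{Re}(\alpha+\beta'-\gamma)\}.$$ Let $I_{0,-}^{\alpha,\alpha',\beta,\beta',\gamma}$ be the Marichev–Saigo–Maeda fractional integral $$\bigl(I_{0,-}^{\alpha,\alpha',\beta,\beta',\gamma}f\bigr)(x)=\frac{x^{-\alpha'}}{\Gamma(\gamma)}\int_x^\infty (t-x)^{\gamma-1}t^{-\alpha}F_3\Bigl(\alpha,\alpha',\beta,\beta';\gamma;1-\frac xt,1-\frac tx\Bigr)f(t)\,dt,$$ where $F_3(a,a',b,b';c;u,v)=\sum_{m,n\ge0}\frac{(a)_m(a')_n(b)_m(b')_n}{(c)_{m+n}\,m!\,n!}u^mv^n$ $(|u|,|v|<1)$ is Appell's third function, continued analytically in $v$ to $|u|<1$, $v\in(-\infty,0]$. Let $${}_p\psi_q\left[\begin{matrix}(a_i,\alpha_i)_{1,p}\\(b_j,\beta_j)_{1,q}\end{matrix}\,\Big|\,z\right]=\sum_{k=0}^\infty\frac{\prod_{i=1}^p\Gamma(a_i+\alpha_ik)}{\prod_{j=1}^q\Gamma(b_j+\beta_jk)}\frac{z^k}{k!}$$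 be the generalized Wright function, with $1/\Gamma=0$ at the poles of $\Gamma$, and put $$\Psi(z)={}_3\psi_4\left[\begin{matrix}(-\rho-\gamma+\alpha+\alpha',2),\ (-\rho+\alpha+\beta'-\gamma,2),\ (-\rho-\beta,2)\\(-\rho,2),\ (-\rho-\gamma+\alpha+\alpha'+\beta',2),\ (-\rho+\alpha-\beta,2),\ (\tfrac12,1)\end{matrix}\,\Big|\,z\right].$$ Then $$\Bigl(I_{0,-}^{\alpha,\alpha',\beta,\beta',\gamma}\;t^{\rho}\cos\frac ct\Bigr)(x)=\sqrt\pi\,x^{\rho-\alpha-\alpha'+\gamma}\,\Psi\Bigl(-\frac{c^2}{4x^2}\Bigr)$$ and $$\Bigl(I_{0,-}^{\alpha,\alpha',\beta,\beta',\gamma}\;t^{\rho}\cosh\frac ct\Bigr)(x)=\sqrt\pi\,x^{\rho-\alpha-\alpha'+\gamma}\,\Psi\Bigl(\frac{c^2}{4x^2}\Bigr),$$ where the integrals and the series on both sides converge absolutely. -/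

import Mathlib

open MeasureTheory Set

noncomputable section

namespace MSM

/-- The Pochhammer symbol `(a)_n = a (a + 1) ⋯ (a + n - 1)`. -/
def poch (a : ℂ) (n : ℕ) : ℂ := (ascPochhammer ℂ n).eval a

/-- The Gauss hypergeometric function `₂F₁(a, b; c; z)` for `‖z‖ < 1` or `Re z < 1/2`: the
hypergeometric series in the unit disc, and its analytic continuation, given by the Pfaff
transformation `₂F₁(a, b; c; z) = (1 - z)^(-a) ₂F₁(a, c - b; c; z / (z - 1))`, on the rest of the
half-plane `Re z < 1/2` (where `‖z / (z - 1)‖ < 1`). Only `z ∈ (-∞, 0]` is used below. -/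
def gaussF (a b c z : ℂ) : ℂ :=
  if ‖z‖ < 1 then ₂F₁ a b c z
  else (1 - z) ^ (-a) * ₂F₁ a (c - b) c (z / (z - 1))

/-- The double power series of Appell's (Horn's) function `F₃`,
`∑_{m,n} (a)_m (a')_n (b)_m (b')_n / ((c)_{m+n} m! n!) u^m v^n`, for `‖u‖ < 1` and `‖v‖ < 1`. -/
def appellF3Series (a a' b b' c u v : ℂ) : ℂ :=
  ∑' m : ℕ, ∑' n : ℕ,
    poch a m * poch a' n * poch b m * poch b' n /
      (poch c (m + n) * (m.factorial : ℂ) * (n.factorial : ℂ)) * u ^ m * v ^ n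

/-- Appell's function `F₃(a, a', b, b'; c; u, v)` for `‖u‖ < 1` and (`‖v‖ < 1` or `Re v < 1/2`).
In the bidisc it is the double power series (see `appellF3_eq_series`). Summing that series over
`n` first gives `∑_m (a)_m (b)_m / ((c)_m m!) u^m ₂F₁(a', b'; c + m; v)`, and this is its
analytic continuation in `v`. -/
def appellF3 (a a' b b' c u v : ℂ) : ℂ :=
  ∑' m : ℕ, poch a m * poch b m / (poch c m * (m.factorial : ℂ)) * u ^ m *
    gaussF a' b' (c + m) v

lemma poch_add (c : ℂ) (m n : ℕ) : poch c (m + n) = poch c m * poch (c + m) n := by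
  simp only [poch]
  rw [← ascPochhammer_mul]
  simp [Polynomial.eval_comp]

/-- In the bidisc `appellF3` is the double power series. -/
theorem appellF3_eq_series (a a' b b' c u v : ℂ) (hv : ‖v‖ < 1) :
    appellF3 a a' b b' c u v = appellF3Series a a' b b' c u v := by
  unfold appellF3 appellF3Series
  refine tsum_congr fun m => ?_
  rw [gaussF, if_pos hv, ordinaryHypergeometric_eq_tsum, ← tsum_mul_left]
  refine tsum_congr fun n => ?_
  rw [poch_add]
  simp only [poch, smul_eq_mul, div_eq_mul_inv, mul_inv]
  ring

/-- The integrand `(t - x)^(γ-1) t^(-α) F₃(α, α', β, β'; γ; 1 - x/t, 1 - t/x) f(t)`. -/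
def rightIntegrand (α α' β β' γ : ℂ) (f : ℝ → ℂ) (x t : ℝ) : ℂ :=
  ((t - x : ℝ) : ℂ) ^ (γ - 1) * (t : ℂ) ^ (-α) *
    appellF3 α α' β β' γ (1 - (x : ℂ) / (t : ℂ)) (1 - (t : ℂ) / (x : ℂ)) * f t

/-- The right-sided Marichev-Saigo-Maeda fractional integral
`(I_{0,-}^{α,α',β,β',γ} f)(x) = x^(-α') / Γ(γ) ∫_x^∞ (t - x)^(γ-1) t^(-α) F₃(…) f(t) dt`. -/
def rightFracInt (α α' β β' γ : ℂ) (f : ℝ → ℂ) (x : ℝ) : ℂ :=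
  (x : ℂ) ^ (-α') / Complex.Gamma γ * ∫ t in Ioi x, rightIntegrand α α' β β' γ f x t

/-- The `k`-th term of the generalized Wright series. Mathlib's `Gamma` is `0` at the poles
`0, -1, -2, …`, so that `1 / Γ = 0` there, the value of the entire function `1 / Γ`. -/
def wrightTerm {p q : ℕ} (a : Fin p → ℂ × ℝ) (b : Fin q → ℂ × ℝ) (z : ℂ) (k : ℕ) : ℂ :=
  (∏ i, Complex.Gamma ((a i).1 + ((a i).2 : ℂ) * k)) /
    (∏ j, Complex.Gamma ((b j).1 + ((b j).2 : ℂ) * k)) * (z ^ k / (k.factorial : ℂ))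

/-- The generalized Wright function `ₚψ_q[(a_i, α_i); (b_j, β_j) | z]`. -/
def wrightPsi {p q : ℕ} (a : Fin p → ℂ × ℝ) (b : Fin q → ℂ × ℝ) (z : ℂ) : ℂ :=
  ∑' k : ℕ, wrightTerm a b z k

/-- The top parameters of the Wright functions in the theorem. -/
def topParams (α α' β β' γ ρ : ℂ) : Fin 3 → ℂ × ℝ :=
  ![(-ρ - γ + α + α', 2), (-ρ + α + β' - γ, 2), (-ρ - β, 2)]

/-- The bottom parameters of the Wright functions in the theorem. -/
def bottomParams (α α' β β' γ ρ : ℂ) : Fin 4 → ℂ × ℝ :=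
  ![(-ρ, 2), (-ρ - γ + α + α' + β', 2), (-ρ + α - β, 2), (1 / 2, 1)]

end MSM

end

/-!
The fractional integral of a power `t ^ ρ` is a product of Gamma functions, and the theorem follows
by integrating the Taylor series of `cos (c / t)` term by term: the `k`-th term is the fractional
integral of `t ^ (ρ - 2 k)`, whose hypotheses are weaker than those for `t ^ ρ`, and Legendre's
duplication formula turns `(2 k)!` into the factor `Γ(k + 1 / 2)` of the Wright series. On `t > x`
the Taylor series is dominated by that of `cosh (‖c‖ / x)`, so the integrability for `t ^ ρ`
justifies the interchange (`rightFracInt_cos`). The hyperbolic cosine is the case of `c i`.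

For the power `t ^ ρ` put `w = 1 - x / t ∈ (0, 1)` and `σ = α - ρ`. Then `1 - t / x = -w / (1 - w)`,
and Pfaff's transformation (`gaussF_eq`) writes `F₃(α, α', β, β'; γ; 1 - x / t, 1 - t / x)` as
`(1 - w) ^ α'` times a double power series in `w`. Integrated against
`w ^ (γ - 1) (1 - w) ^ (σ - γ - 1)`, the terms are beta integrals, and both the sum over the second
index and the sum over the first one are evaluated by Gauss's theorem `tsum_gaussTerm`, in the form
divided by `Γ(c)`, since `σ` may be a pole of `Γ`. The double series of integrals
converges absolutely when `Re α' > 0` (`integral_unitIntegrand_of_re_pos`), as the growth rate of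
Pochhammer symbols shows. It can diverge for other `α'`; there the contiguous relation
`F₃(α', β'; γ) = F₃(α' + 1, β'; γ) - (β' / γ) v F₃(α' + 1, β' + 1; γ + 1)`, with
`v` the second variable, is used repeatedly (`integral_unitIntegrand`). It preserves
the hypotheses, because they only involve `σ + α' - γ`, `σ + β' - γ` and `σ - α - β`.

Gauss's theorem is proved from the contiguous relation which shifts `c`, iterated to infinity, where
Euler's limit for the Gamma function applies.
-/

noncomputable section

namespace MSM

open Filter
open scoped Topology

/-! ### Growth of Pochhammer symbols -/

lemma poch_zero (a : ℂ) : poch a 0 = 1 := by simp [poch]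

lemma poch_succ (a : ℂ) (n : ℕ) : poch a (n + 1) = poch a n * (a + n) := by
  simp [poch, ascPochhammer_succ_eval]

lemma poch_one (a : ℂ) : poch a 1 = a := by simp [poch]

lemma poch_succ_left (a : ℂ) (n : ℕ) : poch a (n + 1) = a * poch (a + 1) n := by
  rw [add_comm n 1, poch_add, poch_one, Nat.cast_one]

lemma poch_eq_prod (a : ℂ) (n : ℕ) : poch a n = ∏ j ∈ Finset.range n, (a + j) := by
  induction n with
  | zero => simp [poch_zero]
  | succ n ih => rw [poch_succ, ih, Finset.prod_range_succ]

lemma poch_ne_zero {a : ℂ} (ha : 0 < a.re) (n : ℕ) : poch a n ≠ 0 := by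
  rw [poch_eq_prod, Finset.prod_ne_zero_iff]
  intro j _ h
  have := congrArg Complex.re h
  simp at this
  have : (0 : ℝ) ≤ j := Nat.cast_nonneg j
  linarith

lemma add_natCast_re_pos {a : ℂ} (ha : 0 < a.re) (n : ℕ) : 0 < (a + n).re := by
  simp only [Complex.add_re, Complex.natCast_re]; positivity

lemma ne_zero_of_re_pos {a : ℂ} (ha : 0 < a.re) : a ≠ 0 := by
  rintro rfl; simp at ha

lemma Gamma_add_natCast {a : ℂ} (ha : 0 < a.re) (n : ℕ) :
    Complex.Gamma (a + n) = poch a n * Complex.Gamma a := by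
  induction n with
  | zero => simp [poch_zero]
  | succ n ih =>
    rw [poch_succ, Nat.cast_succ, ← add_assoc,
      Complex.Gamma_add_one _ (ne_zero_of_re_pos (add_natCast_re_pos ha n)), ih]
    ring

/-- Euler's limit for `1 / Γ`, valid at the poles of `Γ` as well. -/
lemma tendsto_poch_div (s : ℂ) :
    Tendsto (fun n : ℕ => poch s (n + 1) / ((n : ℂ) ^ s * (n.factorial : ℂ))) atTop
      (𝓝 (Complex.Gamma s)⁻¹) := by
  by_cases h : Complex.Gamma s = 0
  · obtain ⟨m, rfl⟩ := (Complex.Gamma_eq_zero_iff s).1 h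
    rw [h, inv_zero]
    refine tendsto_const_nhds.congr' ?_
    filter_upwards [eventually_ge_atTop m] with n hn
    rw [poch_eq_prod, Finset.prod_eq_zero (i := m) (by simp; omega) (by simp), zero_div]
  · refine ((Complex.GammaSeq_tendsto_Gamma s).inv₀ h).congr fun n => ?_
    rw [Complex.GammaSeq, inv_div, poch_eq_prod]

/-- The growth of the Pochhammer symbol: `‖(s)_n‖ ~ n! n ^ (Re s - 1) / ‖Γ(s)‖`. -/
lemma tendsto_norm_poch_div (s : ℂ) :
    Tendsto (fun n : ℕ => ‖poch s n‖ / ((n.factorial : ℝ) * ((n : ℝ) + 1) ^ (s.re - 1))) atTop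
      (𝓝 ‖(Complex.Gamma s)⁻¹‖) := by
  rw [← tendsto_add_atTop_iff_nat 1]
  have h1 : Tendsto (fun n : ℕ => ((n : ℝ) / (n + 2)) ^ s.re) atTop (𝓝 1) := by
    have := (tendsto_natCast_div_add_atTop (2 : ℝ)).rpow_const (p := s.re) (Or.inl one_ne_zero)
    simpa using this
  have h2 : Tendsto (fun n : ℕ => ((n : ℝ) + 2) / (n + 1)) atTop (𝓝 1) := by
    have := (tendsto_one_div_add_atTop_nhds_zero_nat (𝕜 := ℝ)).const_add 1
    rw [add_zero] at this
    refine this.congr fun n => ?_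
    field_simp; ring
  have h3 := (tendsto_poch_div s).norm.mul (h1.mul h2)
  rw [one_mul, mul_one] at h3
  refine h3.congr' ?_
  filter_upwards [eventually_ge_atTop 1] with n hn
  have hn' : (0 : ℝ) < n := by exact_mod_cast hn
  rw [norm_div, norm_mul, Complex.norm_natCast, Complex.norm_natCast_cpow_of_pos (by omega),
    Real.div_rpow hn'.le (by positivity), Nat.factorial_succ]
  push_cast
  rw [show ((n : ℝ) + 1 + 1) = n + 2 by ring, Real.rpow_sub_one (by positivity)]
  have := Real.rpow_pos_of_pos hn' s.re
  have : 0 < ((n : ℝ) + 2) ^ s.re := Real.rpow_pos_of_pos (by positivity) _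
  have : (0 : ℝ) < n.factorial := by positivity
  field_simp

lemma exists_norm_poch_le (s : ℂ) : ∃ C : ℝ, 0 < C ∧ ∀ n : ℕ,
    ‖poch s n‖ ≤ C * ((n.factorial : ℝ) * ((n : ℝ) + 1) ^ (s.re - 1)) := by
  obtain ⟨C, hC⟩ := (tendsto_norm_poch_div s).bddAbove_range
  refine ⟨max C 1, by positivity, fun n => ?_⟩
  have hp : 0 < (n.factorial : ℝ) * ((n : ℝ) + 1) ^ (s.re - 1) := by positivity
  rw [← div_le_iff₀ hp]
  exact (hC ⟨n, rfl⟩).trans (le_max_left _ _)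

lemma exists_le_norm_poch {s : ℂ} (hs : 0 < s.re) : ∃ C : ℝ, 0 < C ∧ ∀ n : ℕ,
    (n.factorial : ℝ) * ((n : ℝ) + 1) ^ (s.re - 1) ≤ C * ‖poch s n‖ := by
  have hG : Complex.Gamma s ≠ 0 := Complex.Gamma_ne_zero_of_re_pos hs
  obtain ⟨C, hC⟩ := ((tendsto_norm_poch_div s).inv₀ (by simpa using hG)).bddAbove_range
  refine ⟨max C 1, by positivity, fun n => ?_⟩
  have hp : 0 < ‖poch s n‖ := norm_pos_iff.2 (poch_ne_zero hs n)
  rw [← div_le_iff₀ hp]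
  have := hC ⟨n, rfl⟩
  simp only [inv_div] at this
  exact this.trans (le_max_left _ _)

/-- A bound for the ratio `(d)_{m+n} / (d)_m` which is uniform in `m` and `n`, and which makes
sense when `(d)_m` vanishes. -/
lemma exists_norm_poch_add_le (d : ℂ) : ∃ C : ℝ, 0 < C ∧ ∀ m n : ℕ,
    ‖poch (d + m) n‖ ≤ C * (((m + n).factorial : ℝ) / m.factorial *
      (((m : ℝ) + n + 1) ^ (d.re - 1) * ((m : ℝ) + 1) ^ (1 - d.re))) := by
  obtain ⟨k, hk⟩ := exists_nat_gt (-d.re)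
  induction k generalizing d with
  | zero =>
    have hd : 0 < d.re := by simp at hk; exact hk
    obtain ⟨C, hC, h⟩ := exists_norm_poch_le d
    obtain ⟨D, hD, h'⟩ := exists_le_norm_poch hd
    refine ⟨C * D, by positivity, fun m n => ?_⟩
    have h1 := h (m + n)
    have h2 := h' m
    rw [poch_add, norm_mul] at h1
    have hp : 0 < ‖poch d m‖ := norm_pos_iff.2 (poch_ne_zero hd m)
    rw [← mul_le_mul_iff_right₀ hp]
    refine h1.trans ?_
    push_cast
    rw [show 1 - d.re = -(d.re - 1) by ring, Real.rpow_neg (by positivity)]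
    set A := ((m + n).factorial : ℝ) * ((m : ℝ) + n + 1) ^ (d.re - 1)
    set B := (m.factorial : ℝ) * ((m : ℝ) + 1) ^ (d.re - 1)
    have hA : 0 ≤ A := by positivity
    have hB : 0 < B := by positivity
    calc C * A = C * A / B * B := by field_simp
      _ ≤ C * A / B * (D * ‖poch d m‖) := by gcongr
      _ = _ := by simp only [A, B]; field_simp
  | succ k ih =>
    obtain ⟨C, hC, h⟩ := ih (d + 1) (by push_cast at hk; simp; linarith)
    -- The step uses `(d + m)_{n+1} = (d + m) (d + 1 + m)_n`; it remains to compare the powers of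
    -- `m + n + 1` and `m + n + 2`.
    have hcmp : ∀ x : ℝ, 1 ≤ x → x ^ (d.re - 1) ≤ 2 ^ |d.re - 1| * (x + 1) ^ (d.re - 1) := by
      intro x hx
      rcases le_or_gt 0 (d.re - 1) with h0 | h0
      · have : x ^ (d.re - 1) ≤ (x + 1) ^ (d.re - 1) :=
          Real.rpow_le_rpow (by linarith) (by linarith) h0
        have h2 : (1 : ℝ) ≤ 2 ^ |d.re - 1| := Real.one_le_rpow (by norm_num) (abs_nonneg _)
        exact this.trans (le_mul_of_one_le_left (by positivity) h2)
      · rw [abs_of_neg h0, Real.rpow_neg (by norm_num), ← div_eq_inv_mul,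
          ← Real.div_rpow (by linarith) (by norm_num)]
        exact Real.rpow_le_rpow_of_nonpos (by linarith) (by linarith) h0.le
    refine ⟨max 1 ((‖d‖ + 1) * C * 2 ^ |d.re - 1|), by positivity, fun m n => ?_⟩
    rcases n with _ | n
    · have : ((m : ℝ) + 1) ^ (d.re - 1) * ((m : ℝ) + 1) ^ (1 - d.re) = 1 := by
        rw [← Real.rpow_add (by positivity)]; simp
      have hm : (m.factorial : ℝ) ≠ 0 := by positivity
      simp [poch_zero, this, hm]
    · rw [poch_succ_left, norm_mul]
      have h1 := h m n
      rw [show d + 1 + (m : ℂ) = d + m + 1 by ring] at h1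
      have h2 : ‖d + m‖ ≤ (‖d‖ + 1) * ((m : ℝ) + 1) := by
        refine (norm_add_le _ _).trans ?_
        rw [Complex.norm_natCast]
        nlinarith [norm_nonneg d, Nat.cast_nonneg (α := ℝ) m]
      have h3 := hcmp ((m : ℝ) + n + 1) (le_add_of_nonneg_left (by positivity))
      have e1 : (d + 1).re - 1 = (d.re - 1) + 1 := by simp
      have e2 : 1 - (d + 1).re = (1 - d.re) - 1 := by simp
      rw [e1, e2, Real.rpow_add_one (by positivity), Real.rpow_sub_one (by positivity) (1 - d.re)]
        at h1
      have e3 : ((m + (n + 1)).factorial : ℝ) = ((m : ℝ) + n + 1) * (m + n).factorial := by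
        rw [← add_assoc, Nat.factorial_succ]; push_cast; ring
      rw [e3]
      push_cast
      calc ‖d + m‖ * ‖poch (d + m + 1) n‖
          ≤ ((‖d‖ + 1) * ((m : ℝ) + 1)) * (C * ((m + n).factorial / m.factorial *
            (((m : ℝ) + n + 1) ^ (d.re - 1) * (m + n + 1) *
              ((m + 1) ^ (1 - d.re) / (m + 1))))) := by gcongr
        _ = (‖d‖ + 1) * C * (((m : ℝ) + n + 1) * (m + n).factorial / m.factorial *
            (((m : ℝ) + n + 1) ^ (d.re - 1) * (m + 1) ^ (1 - d.re))) := by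
          have : ((m : ℝ) + 1) ≠ 0 := by positivity
          field_simp
        _ ≤ (‖d‖ + 1) * C * (((m : ℝ) + n + 1) * (m + n).factorial / m.factorial *
            ((2 ^ |d.re - 1| * ((m : ℝ) + n + 1 + 1) ^ (d.re - 1)) * (m + 1) ^ (1 - d.re))) := by
          gcongr
        _ = ((‖d‖ + 1) * C * 2 ^ |d.re - 1|) * (((m : ℝ) + n + 1) * (m + n).factorial /
            m.factorial * (((m : ℝ) + (n + 1) + 1) ^ (d.re - 1) * (m + 1) ^ (1 - d.re))) := by
          rw [show (m : ℝ) + n + 1 + 1 = m + (n + 1) + 1 by ring]; ring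
        _ ≤ _ := by gcongr; exact le_max_right _ _

/-! ### Gauss's summation theorem -/

lemma summable_rpow_add_one {p : ℝ} (hp : p < -1) :
    Summable fun n : ℕ => ((n : ℝ) + 1) ^ p := by
  have := (summable_nat_add_iff 1).2 (Real.summable_nat_rpow.2 hp)
  simpa using this

lemma inv_Gamma_eq (z : ℂ) : (Complex.Gamma z)⁻¹ = z * (Complex.Gamma (z + 1))⁻¹ := by
  simpa using Complex.one_div_Gamma_eq_self_mul_one_div_Gamma_add_one z

lemma exists_norm_inv_Gamma_le (c : ℂ) : ∃ C : ℝ, 0 < C ∧ ∀ n : ℕ,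
    ‖(Complex.Gamma (c + n))⁻¹‖ ≤ C * (((n : ℝ) + 1) ^ (1 - c.re) / n.factorial) := by
  obtain ⟨k, hk⟩ := exists_nat_gt (-c.re)
  induction k generalizing c with
  | zero =>
    have hc : 0 < c.re := by simp at hk; exact hk
    obtain ⟨D, hD, h⟩ := exists_le_norm_poch hc
    have hG : 0 < ‖Complex.Gamma c‖ := norm_pos_iff.2 (Complex.Gamma_ne_zero_of_re_pos hc)
    refine ⟨D / ‖Complex.Gamma c‖, by positivity, fun n => ?_⟩
    have hp : 0 < ‖poch c n‖ := norm_pos_iff.2 (poch_ne_zero hc n)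
    have hA : 0 < (n.factorial : ℝ) * ((n : ℝ) + 1) ^ (c.re - 1) := by positivity
    rw [Gamma_add_natCast hc, norm_inv, norm_mul, show 1 - c.re = -(c.re - 1) by ring,
      Real.rpow_neg (by positivity)]
    calc (‖poch c n‖ * ‖Complex.Gamma c‖)⁻¹ = 1 / ‖poch c n‖ / ‖Complex.Gamma c‖ := by field_simp
      _ ≤ D / ((n.factorial : ℝ) * ((n : ℝ) + 1) ^ (c.re - 1)) / ‖Complex.Gamma c‖ := by
        gcongr ?_ / _
        rw [div_le_div_iff₀ hp hA, one_mul]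
        exact h n
      _ = _ := by field_simp
  | succ k ih =>
    obtain ⟨C, hC, h⟩ := ih (c + 1) (by push_cast at hk; simp; linarith)
    -- `1 / Γ(c + n) = (c + n) / Γ(c + n + 1)`, also at the poles
    refine ⟨(‖c‖ + 1) * C, by positivity, fun n => ?_⟩
    have h1 := h n
    rw [show 1 - (c + 1).re = (1 - c.re) - 1 by simp,
      Real.rpow_sub_one (by positivity) (1 - c.re)] at h1
    rw [inv_Gamma_eq, norm_mul, add_right_comm]
    have h2 : ‖c + n‖ ≤ (‖c‖ + 1) * ((n : ℝ) + 1) := by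
      refine (norm_add_le _ _).trans ?_
      rw [Complex.norm_natCast]
      nlinarith [norm_nonneg c, Nat.cast_nonneg (α := ℝ) n]
    calc _ ≤ ((‖c‖ + 1) * ((n : ℝ) + 1)) *
          (C * (((n : ℝ) + 1) ^ (1 - c.re) / (n + 1) / n.factorial)) := by gcongr
      _ = _ := by
        have : ((n : ℝ) + 1) ≠ 0 := by positivity
        field_simp

/-- The `n`-th term of Gauss's series `₂F₁(a, b; c; 1) / Γ(c)`, an entire function of `c`. -/
def gaussTerm (a b c : ℂ) (n : ℕ) : ℂ :=
  poch a n * poch b n * (Complex.Gamma (c + n))⁻¹ / n.factorial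

lemma exists_norm_gaussTerm_le (a b c : ℂ) : ∃ C : ℝ, 0 < C ∧ ∀ n : ℕ,
    ‖gaussTerm a b c n‖ ≤ C * ((n : ℝ) + 1) ^ (-(c - a - b).re - 1) := by
  obtain ⟨A, hA, ha⟩ := exists_norm_poch_le a
  obtain ⟨B, hB, hb⟩ := exists_norm_poch_le b
  obtain ⟨D, hD, hc⟩ := exists_norm_inv_Gamma_le c
  refine ⟨A * B * D, by positivity, fun n => ?_⟩
  have hn : (0 : ℝ) < n.factorial := by positivity
  rw [gaussTerm, norm_div, norm_mul, norm_mul, Complex.norm_natCast]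
  calc _ ≤ A * (n.factorial * ((n : ℝ) + 1) ^ (a.re - 1)) *
        (B * (n.factorial * ((n : ℝ) + 1) ^ (b.re - 1))) *
        (D * (((n : ℝ) + 1) ^ (1 - c.re) / n.factorial)) / n.factorial := by
        gcongr <;> apply_assumption
    _ = A * B * D * (((n : ℝ) + 1) ^ (a.re - 1) * ((n : ℝ) + 1) ^ (b.re - 1) *
        ((n : ℝ) + 1) ^ (1 - c.re)) := by field_simp
    _ = _ := by
      rw [← Real.rpow_add (by positivity), ← Real.rpow_add (by positivity)]
      congr 2
      simp; ring

lemma summable_norm_gaussTerm {a b c : ℂ} (h : 0 < (c - a - b).re) :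
    Summable fun n => ‖gaussTerm a b c n‖ := by
  obtain ⟨C, _, hC⟩ := exists_norm_gaussTerm_le a b c
  exact Summable.of_nonneg_of_le (fun _ => norm_nonneg _) hC
    ((summable_rpow_add_one (by linarith)).mul_left C)

lemma summable_gaussTerm {a b c : ℂ} (h : 0 < (c - a - b).re) : Summable (gaussTerm a b c) :=
  (summable_norm_gaussTerm h).of_norm

/-- The contiguous relation which shifts `c` in Gauss's series at `1`; the difference of the two
sides telescopes. -/
lemma tsum_gaussTerm_shift {a b c : ℂ} (h : 0 < (c - a - b).re) :
    (c - a - b) * ∑' n, gaussTerm a b c n =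
      (c - a) * (c - b) * ∑' n, gaussTerm a b (c + 1) n := by
  have h' : 0 < (c + 1 - a - b).re := by
    simp only [Complex.sub_re, Complex.add_re, Complex.one_re] at h ⊢; linarith
  have hs := (summable_gaussTerm h).mul_left (c - a - b)
  have hs' := (summable_gaussTerm h').mul_left ((c - a) * (c - b))
  rw [← tsum_mul_left, ← tsum_mul_left, ← sub_eq_zero, ← hs.tsum_sub hs']
  have hterm : ∀ n, (c - a - b) * gaussTerm a b c n - (c - a) * (c - b) * gaussTerm a b (c + 1) n =
      (n : ℂ) * gaussTerm a b c n - ((n + 1 : ℕ) : ℂ) * gaussTerm a b c (n + 1) := by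
    intro n
    have e1 : (Complex.Gamma (c + n))⁻¹ = (c + n) * (Complex.Gamma (c + 1 + n))⁻¹ := by
      rw [inv_Gamma_eq, add_right_comm]
    have e2 : c + ((n + 1 : ℕ) : ℂ) = c + 1 + n := by push_cast; ring
    have hn : (n.factorial : ℂ) ≠ 0 := by exact_mod_cast n.factorial_ne_zero
    have hn1 : (n : ℂ) + 1 ≠ 0 := by exact_mod_cast n.succ_ne_zero
    simp only [gaussTerm, e1, e2, poch_succ, Nat.factorial_succ]
    push_cast
    field_simp
    ring
  have h0 : Tendsto (fun n : ℕ => (n : ℂ) * gaussTerm a b c n) atTop (𝓝 0) := by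
    obtain ⟨C, hC0, hC⟩ := exists_norm_gaussTerm_le a b c
    refine squeeze_zero_norm (a := fun n : ℕ => C * ((n : ℝ) + 1) ^ (-(c - a - b).re)) ?_ ?_
    · intro n
      rw [norm_mul, Complex.norm_natCast]
      calc (n : ℝ) * ‖gaussTerm a b c n‖
          ≤ (n + 1) * (C * ((n : ℝ) + 1) ^ (-(c - a - b).re - 1)) := by
            gcongr
            · linarith
            · exact hC n
        _ = _ := by
          rw [Real.rpow_sub_one (by positivity)]
          have : ((n : ℝ) + 1) ≠ 0 := by positivity
          field_simp
    · have := ((tendsto_rpow_neg_atTop h).comp (tendsto_natCast_atTop_atTop (R := ℝ)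
        |>.atTop_add (tendsto_const_nhds (x := (1 : ℝ))))).const_mul C
      simpa using this
  have hlim := (hs.sub hs').hasSum.tendsto_sum_nat
  have hpart : ∀ N, ∑ n ∈ Finset.range N, ((c - a - b) * gaussTerm a b c n -
      (c - a) * (c - b) * gaussTerm a b (c + 1) n) = -((N : ℂ) * gaussTerm a b c N) := by
    intro N
    simp_rw [hterm]
    rw [Finset.sum_range_sub' (fun n : ℕ => (n : ℂ) * gaussTerm a b c n)]
    simp
  simp_rw [hpart] at hlim
  simpa using tendsto_nhds_unique hlim h0.neg

/-- The relation `tsum_gaussTerm_shift` iterated `N` times. -/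
lemma tsum_gaussTerm_mul_poch {a b c : ℂ} (h : 0 < (c - a - b).re) (N : ℕ) :
    poch (c - a - b) N * ∑' n, gaussTerm a b c n =
      poch (c - a) N * poch (c - b) N * ∑' n, gaussTerm a b (c + N) n := by
  induction N with
  | zero => simp [poch_zero]
  | succ N ih =>
    have h' : 0 < (c + N - a - b).re := by
      simp only [Complex.sub_re, Complex.add_re, Complex.natCast_re] at h ⊢
      have : (0 : ℝ) ≤ N := Nat.cast_nonneg N
      linarith
    have := tsum_gaussTerm_shift h'
    rw [poch_succ, poch_succ, poch_succ, Nat.cast_succ, ← add_assoc]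
    linear_combination (c - a - b + N) * ih + poch (c - a) N * poch (c - b) N * this

/-- A lower bound for Pochhammer symbols which makes the terms of Gauss's series at `c + N` bounded
uniformly in `N`. -/
lemma norm_poch_le_norm_poch {c d : ℂ} (hc : 0 < c.re) (h : c.re ≤ d.re) (n : ℕ) :
    ‖poch (c.re : ℂ) n‖ ≤ ‖poch d n‖ := by
  rw [poch_eq_prod, poch_eq_prod, norm_prod, norm_prod]
  refine Finset.prod_le_prod (fun _ _ => norm_nonneg _) fun j _ => ?_
  have hj : (0 : ℝ) ≤ j := Nat.cast_nonneg j
  rw [show (c.re : ℂ) + j = ((c.re + j : ℝ) : ℂ) by push_cast; rfl, Complex.norm_real,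
    Real.norm_of_nonneg (by linarith)]
  refine le_trans ?_ (Complex.re_le_norm _)
  simp only [Complex.add_re, Complex.natCast_re]
  linarith

/-- `₂F₁(a, b; c + N; 1) → 1` as `N → ∞`. -/
lemma tendsto_Gamma_mul_tsum_gaussTerm {a b c : ℂ} (hc : 0 < c.re) (h : 0 < (c - a - b).re) :
    Tendsto (fun N : ℕ => Complex.Gamma (c + N) * ∑' n, gaussTerm a b (c + N) n) atTop (𝓝 1) := by
  have hcN : ∀ N : ℕ, 0 < (c + N).re := fun N => add_natCast_re_pos hc N
  have key : ∀ (d : ℂ), 0 < d.re → ∀ n,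
      Complex.Gamma d * gaussTerm a b d n = poch a n * poch b n / n.factorial * (poch d n)⁻¹ := by
    intro d hd n
    have := Complex.Gamma_ne_zero_of_re_pos hd
    have := poch_ne_zero hd n
    rw [gaussTerm, Gamma_add_natCast hd]
    field_simp
  simp_rw [← tsum_mul_left, key _ (hcN _)]
  have hlim : (1 : ℂ) = ∑' n : ℕ, poch a n * poch b n / n.factorial *
      ∏ _j ∈ Finset.range n, (0 : ℂ) := by
    rw [tsum_eq_single 0]
    · simp [poch_zero]
    · intro n hn; simp [hn]
  rw [hlim]
  refine tendsto_tsum_of_dominated_convergence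
    (bound := fun n => ‖Complex.Gamma (c.re : ℂ) * gaussTerm a b (c.re : ℂ) n‖) ?_ ?_ ?_
  · simp_rw [norm_mul]
    exact (summable_norm_gaussTerm (by simpa using h)).mul_left _
  · intro n
    refine Tendsto.const_mul _ ?_
    simp_rw [poch_eq_prod, ← Finset.prod_inv_distrib]
    refine tendsto_finsetProd _ fun j _ => ?_
    refine tendsto_inv₀_cobounded.comp ?_
    rw [← tendsto_norm_atTop_iff_cobounded]
    refine tendsto_atTop_mono (f := fun N : ℕ => (N : ℝ)) (fun N => ?_)
      tendsto_natCast_atTop_atTop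
    refine le_trans ?_ (Complex.re_le_norm _)
    simp only [Complex.add_re, Complex.natCast_re]
    have : (0 : ℝ) ≤ j := Nat.cast_nonneg j
    linarith
  · refine Eventually.of_forall fun N n => ?_
    rw [key _ (by simpa using hc), norm_mul, norm_mul, norm_inv, norm_inv]
    gcongr
    · exact norm_pos_iff.2 (poch_ne_zero (by simpa using hc) n)
    · exact norm_poch_le_norm_poch hc (by simp) n

/-- **Gauss's summation theorem**, in the form regularized by `1 / Γ(c)`, which also holds when `c`
is a pole of `Γ`. -/
theorem tsum_gaussTerm {a b c : ℂ} (h : 0 < (c - a - b).re) :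
    ∑' n, gaussTerm a b c n =
      Complex.Gamma (c - a - b) * (Complex.Gamma (c - a))⁻¹ * (Complex.Gamma (c - b))⁻¹ := by
  -- both sides satisfy the same recurrence in `c`, which reduces to the case `Re c > 0`
  obtain ⟨k, hk⟩ := exists_nat_gt (-c.re)
  induction k generalizing c with
  | zero =>
    have hc : 0 < c.re := by simp at hk; exact hk
    have h1 := (tendsto_add_atTop_iff_nat 1).2 (tendsto_Gamma_mul_tsum_gaussTerm hc h)
    have hG : Complex.Gamma c ≠ 0 := Complex.Gamma_ne_zero_of_re_pos hc
    have hG' : Complex.Gamma (c - a - b) ≠ 0 := Complex.Gamma_ne_zero_of_re_pos h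
    have h2 := (((tendsto_poch_div (c - a)).mul (tendsto_poch_div (c - b))).div
      ((tendsto_poch_div (c - a - b)).mul (tendsto_poch_div c)) (by simp [hG, hG'])).mul h1
    have h3 : Tendsto (fun _ : ℕ => Complex.Gamma c * ∑' n, gaussTerm a b c n) atTop (𝓝
        ((Complex.Gamma (c - a))⁻¹ * (Complex.Gamma (c - b))⁻¹ /
          ((Complex.Gamma (c - a - b))⁻¹ * (Complex.Gamma c)⁻¹) * 1)) := by
      refine h2.congr' ?_
      filter_upwards [eventually_ne_atTop 0] with N hN
      have hN' : (N : ℂ) ≠ 0 := by exact_mod_cast hN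
      have e := tsum_gaussTerm_mul_poch h (N + 1)
      rw [Gamma_add_natCast hc]
      have hp1 := poch_ne_zero h (N + 1)
      have hp2 := poch_ne_zero hc (N + 1)
      have hq : ∀ s : ℂ, (N : ℂ) ^ s ≠ 0 := fun s => by
        rw [Complex.cpow_ne_zero_iff]; exact Or.inl hN'
      have hf : (N.factorial : ℂ) ≠ 0 := by exact_mod_cast N.factorial_ne_zero
      have hpow : (N : ℂ) ^ (c - a) * (N : ℂ) ^ (c - b) = (N : ℂ) ^ (c - a - b) * (N : ℂ) ^ c := by
        rw [← Complex.cpow_add _ _ hN', ← Complex.cpow_add _ _ hN']; congr 1; ring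
      generalize (∑' n, gaussTerm a b (c + ((N + 1 : ℕ) : ℂ)) n) = X at *
      have : ∑' n, gaussTerm a b c n = poch (c - a) (N + 1) * poch (c - b) (N + 1) * X /
        poch (c - a - b) (N + 1) := by
        rw [eq_div_iff hp1, ← e, mul_comm]
      rw [Pi.div_apply, this]
      have h1 := hq (c - a)
      have h2 := hq (c - b)
      have h3 := hq (c - a - b)
      have h4 := hq c
      field_simp
      linear_combination (-(poch (c - a) (N + 1) * poch (c - b) (N + 1) * X)) * hpow
    have h4 := tendsto_nhds_unique tendsto_const_nhds h3
    rw [← mul_right_inj' hG, h4]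
    field_simp
  | succ k ih =>
    have h' : 0 < (c + 1 - a - b).re := by
      simp only [Complex.sub_re, Complex.add_re, Complex.one_re] at h ⊢; linarith
    have h1 := ih h' (by push_cast at hk; simp; linarith)
    have h2 := tsum_gaussTerm_shift h
    have h0 := ne_zero_of_re_pos h
    rw [← mul_right_inj' h0, h2, h1, inv_Gamma_eq (c - a), inv_Gamma_eq (c - b),
      show c + 1 - a - b = c - a - b + 1 by ring, Complex.Gamma_add_one _ h0,
      show c + 1 - a = c - a + 1 by ring, show c + 1 - b = c - b + 1 by ring]
    ring

/-! ### Pfaff's transformation and a contiguous relation -/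

lemma one_sub_ofReal_ne_zero {w : ℝ} (h : w < 1) : 1 - (w : ℂ) ≠ 0 := by
  rw [sub_ne_zero]
  exact_mod_cast h.ne'

lemma summable_rpow_mul_pow (p : ℝ) {r : ℝ} (h0 : 0 ≤ r) (h1 : r < 1) :
    Summable fun n : ℕ => ((n : ℝ) + 1) ^ p * r ^ n := by
  obtain ⟨q, hrq, hq⟩ := exists_between h1
  have hq0 : 0 < q := h0.trans_lt hrq
  have hq1 : ‖q‖ < 1 := by rwa [Real.norm_of_nonneg hq0.le]
  obtain ⟨k, hk⟩ := exists_nat_ge p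
  have hs : Summable fun n : ℕ => q⁻¹ * (((n + 1 : ℕ) : ℝ) ^ k * q ^ (n + 1)) :=
    ((summable_nat_add_iff (f := fun n : ℕ => (n : ℝ) ^ k * q ^ n) 1).2
      (summable_pow_mul_geometric_of_norm_lt_one k hq1)).mul_left q⁻¹
  refine Summable.of_nonneg_of_le (fun n => by positivity) (fun n => ?_) hs
  have e : q⁻¹ * ((((n + 1 : ℕ) : ℝ)) ^ k * q ^ (n + 1)) = ((n : ℝ) + 1) ^ k * q ^ n := by
    push_cast; rw [pow_succ]; field_simp
  have hp : ((n : ℝ) + 1) ^ p ≤ ((n : ℝ) + 1) ^ k := by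
    rw [← Real.rpow_natCast]
    exact Real.rpow_le_rpow_of_exponent_le (le_add_of_nonneg_left (by positivity)) hk
  rw [e]
  exact mul_le_mul hp (pow_le_pow_left₀ h0 hrq.le n) (by positivity) (by positivity)

/-- The coefficients of the Gauss hypergeometric series. -/
def hypCoeff (a b c : ℂ) (n : ℕ) : ℂ := poch a n * poch b n / (poch c n * n.factorial)

lemma ordinaryHypergeometric_eq_tsum_hypCoeff (a b c z : ℂ) :
    ₂F₁ a b c z = ∑' n, hypCoeff a b c n * z ^ n := by
  rw [ordinaryHypergeometric_eq_tsum]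
  refine tsum_congr fun n => ?_
  simp only [hypCoeff, poch, smul_eq_mul, div_eq_mul_inv, mul_inv]
  ring

lemma summable_norm_hypCoeff {a b c z : ℂ} (hc : 0 < c.re) (hz : ‖z‖ < 1) :
    Summable fun n => ‖hypCoeff a b c n * z ^ n‖ := by
  obtain ⟨C, _, hC⟩ := exists_norm_gaussTerm_le a b c
  refine Summable.of_nonneg_of_le (fun _ => norm_nonneg _) (fun n => ?_)
    ((summable_rpow_mul_pow (-(c - a - b).re - 1) (norm_nonneg z) hz).mul_left
      (‖Complex.Gamma c‖ * C))
  have e : hypCoeff a b c n = Complex.Gamma c * gaussTerm a b c n := by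
    have := Complex.Gamma_ne_zero_of_re_pos hc
    have := poch_ne_zero hc n
    rw [gaussTerm, Gamma_add_natCast hc, hypCoeff]
    field_simp
  rw [e, norm_mul, norm_mul, norm_pow]
  calc _ ≤ ‖Complex.Gamma c‖ * (C * ((n : ℝ) + 1) ^ (-(c - a - b).re - 1)) * ‖z‖ ^ n := by
        gcongr; exact hC n
    _ = _ := by ring

lemma summable_hypCoeff {a b c z : ℂ} (hc : 0 < c.re) (hz : ‖z‖ < 1) :
    Summable fun n => hypCoeff a b c n * z ^ n :=
  (summable_norm_hypCoeff hc hz).of_norm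

/-- The **Chu–Vandermonde identity**. -/
lemma sum_antidiagonal_choose_mul_poch (b c : ℂ) (N : ℕ) :
    ∑ ij ∈ Finset.HasAntidiagonal.antidiagonal N, (N.choose ij.1 : ℂ) *
      ((-1) ^ ij.1 * poch b ij.1 * poch (c + ij.1) ij.2) = poch (c - b) N := by
  induction N generalizing c with
  | zero => simp [poch_zero]
  | succ N ih =>
    rw [Finset.sum_antidiagonal_choose_succ_mul
      (fun i j => (-1 : ℂ) ^ i * poch b i * poch (c + i) j), ← Finset.sum_add_distrib,
      poch_succ_left, show c - b + 1 = c + 1 - b by ring, ← ih (c + 1), Finset.mul_sum]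
    refine Finset.sum_congr rfl fun ij hij => ?_
    rw [Nat.choose_symm_of_eq_add (Finset.HasAntidiagonal.mem_antidiagonal.1 hij).symm,
      poch_succ_left (c + ij.1), poch_succ b]
    push_cast
    rw [show c + ((ij.1 : ℂ) + 1) = c + 1 + ij.1 by ring,
      show c + (ij.1 : ℂ) + 1 = c + 1 + ij.1 by ring]
    ring

lemma hasSum_one_sub_cpow (s : ℂ) {z : ℂ} (hz : ‖z‖ < 1) :
    HasSum (fun k => poch s k / k.factorial * z ^ k) ((1 - z) ^ (-s)) := by
  have h := (Complex.one_div_one_sub_cpow_hasFPowerSeriesOnBall_zero s).hasSum (y := z)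
    (by simpa [enorm_eq_nnnorm, ← NNReal.coe_lt_one] using hz)
  simp only [FormalMultilinearSeries.ofScalars_apply_eq, zero_add, smul_eq_mul] at h
  rw [Complex.cpow_neg, ← one_div]
  refine h.congr_fun fun k => ?_
  have e := Ring.factorial_nsmul_multichoose_eq_ascPochhammer s k
  rw [Ring.multichoose_eq, Polynomial.ascPochhammer_smeval_eq_eval, nsmul_eq_mul] at e
  have hk : (k.factorial : ℂ) ≠ 0 := by exact_mod_cast k.factorial_ne_zero
  rw [poch, ← e]
  field_simp

lemma norm_poch_le_poch {s : ℂ} {r : ℝ} (h : ‖s‖ ≤ r) (n : ℕ) : ‖poch s n‖ ≤ (poch r n).re := by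
  have hr : 0 ≤ r := (norm_nonneg s).trans h
  have e : poch r n = ((∏ j ∈ Finset.range n, (r + j) : ℝ) : ℂ) := by
    rw [poch_eq_prod]; push_cast; rfl
  rw [e, Complex.ofReal_re, poch_eq_prod, norm_prod]
  refine Finset.prod_le_prod (fun _ _ => norm_nonneg _) fun j _ => ?_
  refine (norm_add_le _ _).trans ?_
  rw [Complex.norm_natCast]
  linarith

/-- Absolute convergence of the binomial series, with a bound that keeps the exact exponential rate
in `r`; the coarser polynomial bounds for the coefficients would lose it. -/
lemma summable_norm_binomial {s : ℂ} {r w : ℝ} (h : ‖s‖ ≤ r) (h0 : 0 ≤ w) (h1 : w < 1) :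
    (Summable fun k => ‖poch s k / k.factorial * (w : ℂ) ^ k‖) ∧
      ∑' k, ‖poch s k / k.factorial * (w : ℂ) ^ k‖ ≤ (1 - w) ^ (-r) := by
  have hs := Complex.reCLM.hasSum (hasSum_one_sub_cpow (r : ℂ) (z := (w : ℂ))
    (by rwa [Complex.norm_real, Real.norm_of_nonneg h0]))
  have e : Complex.reCLM ((1 - (w : ℂ)) ^ (-(r : ℂ))) = (1 - w) ^ (-r) := by
    rw [show (1 - (w : ℂ)) = ((1 - w : ℝ) : ℂ) by push_cast; rfl,
      show (-(r : ℂ)) = ((-r : ℝ) : ℂ) by push_cast; rfl,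
      ← Complex.ofReal_cpow (by linarith)]
    simp
  rw [e] at hs
  have hle : ∀ k : ℕ, ‖poch s k / k.factorial * (w : ℂ) ^ k‖ ≤
      (Complex.reCLM ∘ fun k => poch (r : ℂ) k / k.factorial * (w : ℂ) ^ k) k := by
    intro k
    have e2 : (poch (r : ℂ) k / k.factorial * (w : ℂ) ^ k).re =
        (poch (r : ℂ) k).re / k.factorial * w ^ k := by
      rw [← Complex.ofReal_pow, Complex.re_mul_ofReal, ← Complex.ofReal_natCast,
        Complex.div_ofReal_re]
    simp only [Function.comp, Complex.reCLM_apply, e2, norm_mul, norm_div, norm_pow,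
      Complex.norm_real, Real.norm_of_nonneg h0, Complex.norm_natCast]
    gcongr
    exact norm_poch_le_poch h k
  have hsum := Summable.of_nonneg_of_le (fun _ => norm_nonneg _) hle hs.summable
  exact ⟨hsum, (hsum.tsum_le_tsum hle hs.summable).trans hs.tsum_eq.le⟩

/-- **Pfaff's transformation** on the segment where both series converge absolutely: the powers
`(1 - w) ^ (-a - n)` are expanded, and the double series is summed along antidiagonals. -/
lemma ordinaryHypergeometric_pfaff {a b c : ℂ} (hc : 0 < c.re) {w : ℝ} (h0 : 0 ≤ w)
    (h1 : w < 1 / 2) :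
    (1 - (w : ℂ)) ^ (-a) * ₂F₁ a b c (-(w : ℂ) / (1 - w)) = ₂F₁ a (c - b) c (w : ℂ) := by
  have hw : (1 - (w : ℂ)) ≠ 0 := one_sub_ofReal_ne_zero (h1.trans (by norm_num))
  have hw1 : ‖(w : ℂ)‖ < 1 := by rw [Complex.norm_real, Real.norm_of_nonneg h0]; linarith
  have hn1 : ‖1 - (w : ℂ)‖ = 1 - w := by
    rw [show (1 - (w : ℂ)) = ((1 - w : ℝ) : ℂ) by push_cast; rfl, Complex.norm_real,
      Real.norm_of_nonneg (by linarith)]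
  have hz : ‖-(w : ℂ) / (1 - w)‖ < 1 := by
    rw [norm_div, norm_neg, hn1, Complex.norm_real, Real.norm_of_nonneg h0,
      div_lt_one (by linarith)]
    linarith
  let f : ℕ × ℕ → ℂ := fun p => hypCoeff a b c p.1 * (-(w : ℂ)) ^ p.1 *
    (poch (a + p.1) p.2 / p.2.factorial * (w : ℂ) ^ p.2)
  have hrow : ∀ n : ℕ, ‖a + n‖ ≤ ‖a‖ + n := fun n => by
    refine (norm_add_le _ _).trans ?_
    rw [Complex.norm_natCast]
  have hf : Summable f := by
    refine Summable.of_norm ?_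
    rw [summable_prod_of_nonneg (fun _ => norm_nonneg _)]
    constructor
    · intro n
      simp only [f, norm_mul (hypCoeff a b c n * _)]
      exact (summable_norm_binomial (hrow n) h0 (by linarith)).1.mul_left _
    · refine Summable.of_nonneg_of_le (fun _ => tsum_nonneg fun _ => norm_nonneg _) (fun n => ?_)
        ((summable_norm_hypCoeff (a := a) (b := b) hc hz).mul_left ((1 - w) ^ (-‖a‖)))
      simp only [f, norm_mul (hypCoeff a b c n * _)]
      rw [tsum_mul_left]
      calc _ ≤ ‖hypCoeff a b c n * (-(w : ℂ)) ^ n‖ * (1 - w) ^ (-(‖a‖ + n)) := by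
            gcongr; exact (summable_norm_binomial (hrow n) h0 (by linarith)).2
        _ = _ := by
          rw [neg_add, Real.rpow_add (by linarith), Real.rpow_neg (by linarith) (n : ℝ),
            Real.rpow_natCast, norm_mul, norm_mul, div_pow, norm_div, norm_pow (1 - (w : ℂ)), hn1]
          ring
  calc (1 - (w : ℂ)) ^ (-a) * ₂F₁ a b c (-(w : ℂ) / (1 - w))
      = ∑' n, ∑' k, f (n, k) := by
        rw [ordinaryHypergeometric_eq_tsum_hypCoeff, ← tsum_mul_left]
        refine tsum_congr fun n => ?_
        simp only [f]
        rw [tsum_mul_left, (hasSum_one_sub_cpow (a + n) hw1).tsum_eq, neg_add,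
          Complex.cpow_add _ _ hw, Complex.cpow_neg _ (n : ℂ), Complex.cpow_natCast, div_pow]
        ring
    _ = ∑' p, f p := (hf.tsum_prod).symm
    _ = ∑' N, ∑ ij ∈ Finset.HasAntidiagonal.antidiagonal N, f ij := by
        rw [← Finset.HasAntidiagonal.sigmaAntidiagonalEquivProd.tsum_eq f]
        have hf' : Summable fun p => f (Finset.HasAntidiagonal.sigmaAntidiagonalEquivProd p) :=
          Finset.HasAntidiagonal.sigmaAntidiagonalEquivProd.summable_iff.2 hf
        rw [hf'.tsum_sigma' (fun N => (hasSum_fintype _).summable)]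
        refine tsum_congr fun N => ?_
        rw [tsum_fintype, ← Finset.sum_finset_coe f]
        rfl
    _ = _ := by
        rw [ordinaryHypergeometric_eq_tsum_hypCoeff]
        refine tsum_congr fun N => ?_
        rw [hypCoeff, ← sum_antidiagonal_choose_mul_poch, Finset.mul_sum, Finset.sum_div,
          Finset.sum_mul]
        refine Finset.sum_congr rfl fun ij hij => ?_
        have hN := Finset.HasAntidiagonal.mem_antidiagonal.1 hij
        simp only [f, hypCoeff]
        rw [← hN, poch_add a, poch_add c, neg_pow (w : ℂ), Nat.choose_symm_add,
          Nat.add_choose, Nat.cast_div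
          (Nat.factorial_mul_factorial_dvd_factorial_add _ _)
          (by exact_mod_cast mul_ne_zero (Nat.factorial_ne_zero _) (Nat.factorial_ne_zero _)),
          pow_add]
        have h1 := poch_ne_zero hc ij.1
        have h2 := poch_ne_zero (add_natCast_re_pos hc ij.1) ij.2
        have h3 : (ij.1.factorial : ℂ) ≠ 0 := by exact_mod_cast ij.1.factorial_ne_zero
        have h4 : (ij.2.factorial : ℂ) ≠ 0 := by exact_mod_cast ij.2.factorial_ne_zero
        have h5 : ((ij.1 + ij.2).factorial : ℂ) ≠ 0 := by
          exact_mod_cast (ij.1 + ij.2).factorial_ne_zero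
        push_cast
        field_simp

/-- On `z < 0`, written as `z = -w / (1 - w)`, both branches of `gaussF` are given by the same
series in `w`. -/
lemma gaussF_eq {a b c : ℂ} (hc : 0 < c.re) {w : ℝ} (h0 : 0 < w) (h1 : w < 1) :
    gaussF a b c (-(w : ℂ) / (1 - w)) = (1 - (w : ℂ)) ^ a * ₂F₁ a (c - b) c (w : ℂ) := by
  have hw : (1 - (w : ℂ)) ≠ 0 := one_sub_ofReal_ne_zero h1
  have hz : ‖-(w : ℂ) / (1 - w)‖ = w / (1 - w) := by
    rw [norm_div, norm_neg, show (1 - (w : ℂ)) = ((1 - w : ℝ) : ℂ) by push_cast; rfl,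
      Complex.norm_real, Complex.norm_real, Real.norm_of_nonneg h0.le,
      Real.norm_of_nonneg (by linarith)]
  have hlt : w / (1 - w) < 1 ↔ w < 1 / 2 := by
    rw [div_lt_one (by linarith)]; constructor <;> intro <;> linarith
  rw [gaussF, hz]
  split_ifs with h
  · rw [← ordinaryHypergeometric_pfaff hc h0.le (hlt.1 h), ← mul_assoc, ← Complex.cpow_add _ _ hw]
    simp
  · have e1 : 1 - -(w : ℂ) / (1 - w) = (1 - (w : ℂ))⁻¹ := by field_simp; ring
    have e2 : -(w : ℂ) / (1 - w) / (-(w : ℂ) / (1 - w) - 1) = w := by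
      rw [show -(w : ℂ) / (1 - w) - 1 = -(1 - (w : ℂ))⁻¹ by rw [← e1]; ring]
      field_simp
    rw [e1, e2, Complex.inv_cpow, Complex.cpow_neg, inv_inv]
    rw [show (1 - (w : ℂ)) = ((1 - w : ℝ) : ℂ) by push_cast; rfl,
      Complex.arg_ofReal_of_nonneg (by linarith)]
    exact Real.pi_ne_zero.symm

/-- The contiguous relation
`₂F₁(a, b; c; z) = ₂F₁(a+1, b; c; z) - (b z / c) ₂F₁(a+1, b+1; c+1; z)` at `z = -w / (1 - w)`. -/
lemma gaussF_contiguous {a b c : ℂ} (hc : 0 < c.re) {w : ℝ} (h0 : 0 < w) (h1 : w < 1) :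
    gaussF a b c (-(w : ℂ) / (1 - w)) = gaussF (a + 1) b c (-(w : ℂ) / (1 - w)) +
      b / c * ((w : ℂ) / (1 - w)) * gaussF (a + 1) (b + 1) (c + 1) (-(w : ℂ) / (1 - w)) := by
  have hc0 := ne_zero_of_re_pos hc
  have hc1 : 0 < (c + 1).re := by simp; linarith
  have hw : (1 - (w : ℂ)) ≠ 0 := one_sub_ofReal_ne_zero h1
  have hw1 : ‖(w : ℂ)‖ < 1 := by rwa [Complex.norm_real, Real.norm_of_nonneg h0.le]
  rw [gaussF_eq hc h0 h1, gaussF_eq hc h0 h1, gaussF_eq hc1 h0 h1,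
    show c + 1 - (b + 1) = c - b by ring, Complex.cpow_add _ _ hw, Complex.cpow_one]
  have key : ₂F₁ a (c - b) c (w : ℂ) = (1 - w) * ₂F₁ (a + 1) (c - b) c (w : ℂ) +
      b / c * w * ₂F₁ (a + 1) (c - b) (c + 1) (w : ℂ) := by
    simp only [ordinaryHypergeometric_eq_tsum_hypCoeff]
    have s1 := summable_hypCoeff (a := a) (b := c - b) hc hw1
    have s2 := summable_hypCoeff (a := a + 1) (b := c - b) hc hw1
    have s3 := summable_hypCoeff (a := a + 1) (b := c - b) hc1 hw1
    rw [sub_mul, one_mul, s1.tsum_eq_zero_add, sub_add, ← tsum_mul_left, ← tsum_mul_left,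
      ← (s2.mul_left _).tsum_sub (s3.mul_left _), s2.tsum_eq_zero_add, add_sub_assoc,
      ← ((summable_nat_add_iff 1).2 s2).tsum_sub ((s2.mul_left _).sub (s3.mul_left _))]
    congr 1
    · simp [hypCoeff, poch_zero]
    · refine tsum_congr fun m => ?_
      have h1 := poch_ne_zero hc m
      have h2 := poch_ne_zero hc1 m
      have h3 : (m.factorial : ℂ) ≠ 0 := by exact_mod_cast m.factorial_ne_zero
      have h4 : (m : ℂ) + 1 ≠ 0 := by exact_mod_cast m.succ_ne_zero
      have h5 := ne_zero_of_re_pos (add_natCast_re_pos hc m)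
      have e : poch (c + 1) m = poch c m * (c + m) / c := by
        rw [eq_div_iff hc0, ← poch_succ, poch_succ_left]; ring
      simp only [hypCoeff, e, poch_succ (c - b), poch_succ c, poch_succ (a + 1), poch_succ_left a,
        Nat.factorial_succ, pow_succ]
      push_cast
      field_simp
      ring
  rw [key]
  field_simp

/-! ### The integral over the unit interval -/

lemma integrable_tsum_of_summable_integral_norm {X ι : Type*} [MeasurableSpace X] {μ : Measure X}
    [Countable ι] {F : ι → X → ℂ} (hF : ∀ i, Integrable (F i) μ)
    (hsum : Summable fun i => ∫ x, ‖F i x‖ ∂μ) (hpt : ∀ᵐ x ∂μ, Summable fun i => F i x) :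
    Integrable (fun x => ∑' i, F i x) μ := by
  constructor
  · refine aestronglyMeasurable_of_tendsto_ae (atTop : Filter (Finset ι))
      (f := fun s x => ∑ i ∈ s, F i x) (fun s => ?_) ?_
    · exact (integrable_finsetSum s fun i _ => hF i).1
    · filter_upwards [hpt] with x hx using hx.hasSum
  · have h1 : ∑' i, ∫⁻ x, ‖F i x‖ₑ ∂μ < ⊤ := by
      have e : ∀ i, ∫⁻ x, ‖F i x‖ₑ ∂μ = ENNReal.ofReal (∫ x, ‖F i x‖ ∂μ) := fun i =>
        (ofReal_integral_norm_eq_lintegral_enorm (hF i)).symm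
      simp_rw [e]
      exact hsum.tsum_ofReal_lt_top
    rw [← lintegral_tsum fun i => (hF i).1.enorm] at h1
    refine lt_of_le_of_lt (lintegral_mono_ae ?_) h1
    filter_upwards [hpt] with x hx
    exact enorm_tsum_le_tsum_enorm

lemma integrableOn_beta {u v : ℂ} (hu : 0 < u.re) (hv : 0 < v.re) :
    IntegrableOn (fun w : ℝ => (w : ℂ) ^ (u - 1) * (1 - (w : ℂ)) ^ (v - 1)) (Ioo 0 1) :=
  (intervalIntegrable_iff_integrableOn_Ioo_of_le zero_le_one).1
    (Complex.betaIntegral_convergent hu hv)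

lemma integral_beta {u v : ℂ} (hu : 0 < u.re) (hv : 0 < v.re) :
    ∫ w : ℝ in Ioo 0 1, (w : ℂ) ^ (u - 1) * (1 - (w : ℂ)) ^ (v - 1) =
      Complex.Gamma u * Complex.Gamma v * (Complex.Gamma (u + v))⁻¹ := by
  rw [Complex.Gamma_mul_Gamma_eq_betaIntegral hu hv, Complex.betaIntegral,
    intervalIntegral.integral_of_le zero_le_one, integral_Ioc_eq_integral_Ioo]
  have : Complex.Gamma (u + v) ≠ 0 :=
    Complex.Gamma_ne_zero_of_re_pos (by rw [Complex.add_re]; linarith)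
  field_simp

lemma norm_beta_integrand (u v : ℂ) {w : ℝ} (hw : w ∈ Ioo (0 : ℝ) 1) :
    ‖(w : ℂ) ^ (u - 1) * (1 - (w : ℂ)) ^ (v - 1)‖ = w ^ (u.re - 1) * (1 - w) ^ (v.re - 1) := by
  rw [norm_mul, show (1 - (w : ℂ)) = ((1 - w : ℝ) : ℂ) by push_cast; rfl,
    Complex.norm_cpow_eq_rpow_re_of_pos hw.1,
    Complex.norm_cpow_eq_rpow_re_of_pos (by linarith [hw.2])]
  simp

lemma integral_norm_beta {u v : ℂ} (hu : 0 < u.re) (hv : 0 < v.re) :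
    ∫ w : ℝ in Ioo 0 1, ‖(w : ℂ) ^ (u - 1) * (1 - (w : ℂ)) ^ (v - 1)‖ =
      ‖Complex.Gamma u.re * Complex.Gamma v.re * (Complex.Gamma (u.re + v.re))⁻¹‖ := by
  rw [← integral_beta (by simpa using hu) (by simpa using hv)]
  have e : ∫ w : ℝ in Ioo 0 1, (w : ℂ) ^ ((u.re : ℂ) - 1) * (1 - (w : ℂ)) ^ ((v.re : ℂ) - 1) =
      ((∫ w : ℝ in Ioo 0 1, w ^ (u.re - 1) * (1 - w) ^ (v.re - 1) : ℝ) : ℂ) := by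
    rw [← integral_complex_ofReal]
    refine setIntegral_congr_fun measurableSet_Ioo fun w hw => ?_
    have h1 : 0 ≤ 1 - w := by linarith [hw.2]
    rw [Complex.ofReal_mul, Complex.ofReal_cpow hw.1.le, Complex.ofReal_cpow h1]
    push_cast
    rfl
  rw [e, Complex.norm_real, Real.norm_of_nonneg
    (setIntegral_nonneg measurableSet_Ioo fun w hw => ?_)]
  · exact setIntegral_congr_fun measurableSet_Ioo fun w hw => norm_beta_integrand u v hw
  · have h1 : 0 ≤ 1 - w := by linarith [hw.2]
    have h0 := hw.1.le
    positivity

lemma exists_integral_norm_beta_le {u v : ℂ} (hu : 0 < u.re) (hv : 0 < v.re) :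
    ∃ C : ℝ, 0 < C ∧ ∀ N : ℕ,
      ∫ w : ℝ in Ioo 0 1, ‖(w : ℂ) ^ (u + N - 1) * (1 - (w : ℂ)) ^ (v - 1)‖ ≤
        C * ((N : ℝ) + 1) ^ (-v.re) := by
  obtain ⟨A, hA, ha⟩ := exists_norm_poch_le (u.re : ℂ)
  obtain ⟨B, hB, hb⟩ := exists_norm_inv_Gamma_le ((u.re : ℂ) + v.re)
  have hG : 0 < ‖Complex.Gamma u.re‖ :=
    norm_pos_iff.2 (Complex.Gamma_ne_zero_of_re_pos (by simpa using hu))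
  have hG' : 0 < ‖Complex.Gamma v.re‖ :=
    norm_pos_iff.2 (Complex.Gamma_ne_zero_of_re_pos (by simpa using hv))
  refine ⟨A * ‖Complex.Gamma u.re‖ * ‖Complex.Gamma v.re‖ * B, by positivity, fun N => ?_⟩
  rw [integral_norm_beta (add_natCast_re_pos hu N) hv]
  have e1 : (((u + N).re : ℝ) : ℂ) = (u.re : ℂ) + N := by simp
  rw [e1, Gamma_add_natCast (by simpa using hu), add_right_comm, norm_mul, norm_mul, norm_mul]
  have h1 := ha N
  have h2 := hb N
  simp only [Complex.ofReal_re, Complex.add_re] at h1 h2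
  have hN : (0 : ℝ) < N.factorial := by positivity
  calc _ ≤ A * (N.factorial * ((N : ℝ) + 1) ^ (u.re - 1)) * ‖Complex.Gamma u.re‖ *
        ‖Complex.Gamma v.re‖ * (B * (((N : ℝ) + 1) ^ (1 - (u.re + v.re)) / N.factorial)) := by
        gcongr
    _ = A * ‖Complex.Gamma u.re‖ * ‖Complex.Gamma v.re‖ * B *
        (((N : ℝ) + 1) ^ (u.re - 1) * ((N : ℝ) + 1) ^ (1 - (u.re + v.re))) := by
        field_simp
    _ = _ := by
      rw [← Real.rpow_add (by positivity)]
      congr 2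
      ring

/-- The coefficients of the double power series in `w` obtained from Appell's function
`F₃(a, a', b, b'; c; w, -w / (1 - w))` by Pfaff's transformation in the second variable, up to the
factor `(1 - w) ^ a'`. -/
def pfaffCoeff (a a' b b' c : ℂ) (p : ℕ × ℕ) : ℂ :=
  hypCoeff a b c p.1 * hypCoeff a' (c + p.1 - b') (c + p.1) p.2

/-- The bound for the double power series; the powers of `m + n` come from the quotient
`(c + m - b')_n / (c + m)_n`. -/
lemma exists_norm_pfaffCoeff_le (a a' b b' : ℂ) {c : ℂ} (hc : 0 < c.re) :
    ∃ C : ℝ, 0 < C ∧ ∀ p : ℕ × ℕ, ‖pfaffCoeff a a' b b' c p‖ ≤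
      C * (((p.1 : ℝ) + 1) ^ ((a + b - c + b').re - 1) * ((p.2 : ℝ) + 1) ^ (a'.re - 1) *
        ((p.1 : ℝ) + p.2 + 1) ^ (-b'.re)) := by
  obtain ⟨A, hA, ha⟩ := exists_norm_poch_le a
  obtain ⟨A', hA', ha'⟩ := exists_norm_poch_le a'
  obtain ⟨B, hB, hb⟩ := exists_norm_poch_le b
  obtain ⟨D, hD, hd⟩ := exists_norm_poch_add_le (c - b')
  obtain ⟨E, hE, he⟩ := exists_le_norm_poch hc
  refine ⟨A * A' * B * D * E, by positivity, fun ⟨m, n⟩ => ?_⟩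
  have hm : (0 : ℝ) < m.factorial := by positivity
  have hn : (0 : ℝ) < n.factorial := by positivity
  have hN : (0 : ℝ) < (m + n).factorial := by positivity
  have hp : 0 < ‖poch c (m + n)‖ := norm_pos_iff.2 (poch_ne_zero hc _)
  have e1 : pfaffCoeff a a' b b' c (m, n) = poch a m * poch b m * poch a' n *
      poch (c - b' + m) n / (poch c (m + n) * m.factorial * n.factorial) := by
    simp only [pfaffCoeff, hypCoeff]
    rw [poch_add c, show c + (m : ℂ) - b' = c - b' + m by ring]
    have := poch_ne_zero hc m
    have := poch_ne_zero (add_natCast_re_pos hc m) n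
    have h3 : (m.factorial : ℂ) ≠ 0 := by exact_mod_cast m.factorial_ne_zero
    have h4 : (n.factorial : ℂ) ≠ 0 := by exact_mod_cast n.factorial_ne_zero
    field_simp
  have e2 : ‖poch c (m + n)‖⁻¹ ≤
      E * (((m : ℝ) + n + 1) ^ (1 - c.re) / (m + n).factorial) := by
    have h := he (m + n)
    push_cast at h
    rw [show 1 - c.re = -(c.re - 1) by ring, Real.rpow_neg (by positivity)]
    rw [inv_le_iff_one_le_mul₀ hp]
    have hq : 0 < ((m + n).factorial : ℝ) * ((m : ℝ) + n + 1) ^ (c.re - 1) := by positivity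
    have e : E * ((((m : ℝ) + n + 1) ^ (c.re - 1))⁻¹ / (m + n).factorial) * ‖poch c (m + n)‖ =
        E * ‖poch c (m + n)‖ / ((m + n).factorial * ((m : ℝ) + n + 1) ^ (c.re - 1)) := by
      field_simp
    rwa [e, one_le_div hq]
  rw [e1, norm_div, norm_mul, norm_mul, norm_mul, norm_mul, norm_mul, Complex.norm_natCast,
    Complex.norm_natCast, div_eq_mul_inv, mul_inv, mul_inv]
  calc _ ≤ A * (m.factorial * ((m : ℝ) + 1) ^ (a.re - 1)) *
        (B * (m.factorial * ((m : ℝ) + 1) ^ (b.re - 1))) *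
        (A' * (n.factorial * ((n : ℝ) + 1) ^ (a'.re - 1))) *
        (D * ((m + n).factorial / m.factorial * (((m : ℝ) + n + 1) ^ ((c - b').re - 1) *
          ((m : ℝ) + 1) ^ (1 - (c - b').re)))) *
        (E * (((m : ℝ) + n + 1) ^ (1 - c.re) / (m + n).factorial) * (m.factorial : ℝ)⁻¹ *
          (n.factorial : ℝ)⁻¹) := by
        gcongr
        · exact ha m
        · exact hb m
        · exact ha' n
        · exact hd m n
    _ = A * A' * B * D * E * ((((m : ℝ) + 1) ^ (a.re - 1) * ((m : ℝ) + 1) ^ (b.re - 1) *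
        ((m : ℝ) + 1) ^ (1 - (c - b').re)) * ((n : ℝ) + 1) ^ (a'.re - 1) *
        (((m : ℝ) + n + 1) ^ ((c - b').re - 1) * ((m : ℝ) + n + 1) ^ (1 - c.re))) := by
        field_simp
    _ = _ := by
      rw [← Real.rpow_add (by positivity), ← Real.rpow_add (by positivity),
        ← Real.rpow_add (by positivity)]
      simp only [Complex.sub_re, Complex.add_re]
      ring_nf

lemma summable_pfaffCoeff_mul_pow (a a' b b' : ℂ) {c : ℂ} (hc : 0 < c.re) {w : ℝ}
    (h0 : 0 < w) (h1 : w < 1) :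
    Summable fun p : ℕ × ℕ => pfaffCoeff a a' b b' c p * (w : ℂ) ^ (p.1 + p.2) := by
  obtain ⟨C, hC0, hC⟩ := exists_norm_pfaffCoeff_le a a' b b' hc
  have hs := ((summable_rpow_mul_pow ((a + b - c + b').re - 1 + |b'.re|) h0.le h1).mul_of_nonneg
    (summable_rpow_mul_pow (a'.re - 1 + |b'.re|) h0.le h1) (fun _ => by positivity)
    (fun _ => by positivity)).mul_left C
  refine Summable.of_norm_bounded hs fun ⟨m, n⟩ => ?_
  have hle : ((m : ℝ) + n + 1) ^ (-b'.re) ≤ ((m : ℝ) + 1) ^ |b'.re| * ((n : ℝ) + 1) ^ |b'.re| := by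
    rw [← Real.mul_rpow (by positivity) (by positivity)]
    have hmn : (0 : ℝ) ≤ m * n := by positivity
    calc ((m : ℝ) + n + 1) ^ (-b'.re) ≤ ((m : ℝ) + n + 1) ^ |b'.re| :=
          Real.rpow_le_rpow_of_exponent_le (le_add_of_nonneg_left (by positivity)) (neg_le_abs _)
      _ ≤ _ := Real.rpow_le_rpow (by positivity) (by linarith) (abs_nonneg _)
  rw [norm_mul, norm_pow, Complex.norm_real, Real.norm_of_nonneg h0.le, pow_add,
    Real.rpow_add (by positivity), Real.rpow_add (by positivity)]
  calc _ ≤ C * (((m : ℝ) + 1) ^ ((a + b - c + b').re - 1) * ((n : ℝ) + 1) ^ (a'.re - 1) *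
        (((m : ℝ) + 1) ^ |b'.re| * ((n : ℝ) + 1) ^ |b'.re|)) * (w ^ m * w ^ n) := by
        gcongr ?_ * _
        exact (hC (m, n)).trans (by gcongr)
    _ = _ := by ring

lemma appellF3_term_eq (a a' b b' : ℂ) {c : ℂ} (hc : 0 < c.re) {w : ℝ} (h0 : 0 < w) (h1 : w < 1)
    (m : ℕ) :
    poch a m * poch b m / (poch c m * (m.factorial : ℂ)) * (w : ℂ) ^ m *
        gaussF a' b' (c + m) (-(w : ℂ) / (1 - w)) =
      (1 - (w : ℂ)) ^ a' * ∑' n, pfaffCoeff a a' b b' c (m, n) * (w : ℂ) ^ (m + n) := by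
  rw [gaussF_eq (add_natCast_re_pos hc m) h0 h1, ordinaryHypergeometric_eq_tsum_hypCoeff,
    ← tsum_mul_left, ← tsum_mul_left, ← tsum_mul_left]
  refine tsum_congr fun n => ?_
  simp only [pfaffCoeff, hypCoeff]
  rw [pow_add]
  ring

lemma summable_appellF3_term (a a' b b' : ℂ) {c : ℂ} (hc : 0 < c.re) {w : ℝ} (h0 : 0 < w)
    (h1 : w < 1) :
    Summable fun m : ℕ => poch a m * poch b m / (poch c m * (m.factorial : ℂ)) * (w : ℂ) ^ m *
        gaussF a' b' (c + m) (-(w : ℂ) / (1 - w)) := by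
  simp_rw [appellF3_term_eq a a' b b' hc h0 h1]
  exact (summable_pfaffCoeff_mul_pow a a' b b' hc h0 h1).prod.mul_left _

lemma appellF3_eq_tsum (a a' b b' : ℂ) {c : ℂ} (hc : 0 < c.re) {w : ℝ} (h0 : 0 < w)
    (h1 : w < 1) :
    appellF3 a a' b b' c w (-(w : ℂ) / (1 - w)) =
      (1 - (w : ℂ)) ^ a' * ∑' p : ℕ × ℕ, pfaffCoeff a a' b b' c p * (w : ℂ) ^ (p.1 + p.2) := by
  rw [appellF3, (summable_pfaffCoeff_mul_pow a a' b b' hc h0 h1).tsum_prod, ← tsum_mul_left]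
  exact tsum_congr fun m => appellF3_term_eq a a' b b' hc h0 h1 m

/-- Raising `a'` by one in `F₃`, at the cost of a second term with `b'` and `c` raised too. -/
lemma appellF3_contiguous (a a' b b' : ℂ) {c : ℂ} (hc : 0 < c.re) {w : ℝ} (h0 : 0 < w)
    (h1 : w < 1) :
    appellF3 a a' b b' c w (-(w : ℂ) / (1 - w)) =
      appellF3 a (a' + 1) b b' c w (-(w : ℂ) / (1 - w)) + b' / c * ((w : ℂ) / (1 - w)) *
        appellF3 a (a' + 1) b (b' + 1) (c + 1) w (-(w : ℂ) / (1 - w)) := by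
  have hc1 : 0 < (c + 1).re := by simp; linarith
  have hc0 := ne_zero_of_re_pos hc
  rw [appellF3, appellF3, appellF3, ← tsum_mul_left,
    ← (summable_appellF3_term a (a' + 1) b b' hc h0 h1).tsum_add
      ((summable_appellF3_term a (a' + 1) b (b' + 1) hc1 h0 h1).mul_left _)]
  refine tsum_congr fun m => ?_
  have hcm := ne_zero_of_re_pos (add_natCast_re_pos hc m)
  rw [gaussF_contiguous (add_natCast_re_pos hc m) h0 h1, add_right_comm c 1]
  have hp := poch_ne_zero hc m
  have e : poch (c + 1) m = poch c m * (c + m) / c := by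
    rw [eq_div_iff hc0, ← poch_succ, poch_succ_left]; ring
  have h3 : (m.factorial : ℂ) ≠ 0 := by exact_mod_cast m.factorial_ne_zero
  rw [e]
  generalize gaussF (a' + 1) (b' + 1) (c + m + 1) _ = X
  generalize gaussF (a' + 1) b' (c + m) _ = Y
  generalize (w : ℂ) / (1 - w) = Z
  field_simp

/-- The integrand of the fractional integral of a power function in the variable
`w = 1 - x / t ∈ (0, 1)`; here `σ = α - ρ`. -/
def unitIntegrand (a a' b b' c σ : ℂ) (w : ℝ) : ℂ :=
  (w : ℂ) ^ (c - 1) * (1 - (w : ℂ)) ^ (σ - c - 1) * appellF3 a a' b b' c w (-(w : ℂ) / (1 - w))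

/-- The value of the integral of `unitIntegrand`. -/
def unitValue (a a' b b' c σ : ℂ) : ℂ :=
  Complex.Gamma c * Complex.Gamma (σ + a' - c) * Complex.Gamma (σ + b' - c) *
    (Complex.Gamma (σ + a' + b' - c))⁻¹ * (Complex.Gamma (σ - a - b) *
      (Complex.Gamma (σ - a))⁻¹ * (Complex.Gamma (σ - b))⁻¹)

/-- If `Re a' > 0`, the double series obtained from Pfaff's transformation can be integrated term by
term over `(0, 1)`. -/
lemma summable_norm_pfaffCoeff_mul_integral {a a' b b' c σ : ℂ} (hc : 0 < c.re)
    (ha' : 0 < a'.re) (h1 : 0 < (σ + a' - c).re) (h2 : 0 < (σ + b' - c).re)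
    (h3 : 0 < (σ - a - b).re) :
    Summable fun p : ℕ × ℕ => ‖pfaffCoeff a a' b b' c p‖ * ∫ w : ℝ in Ioo 0 1,
      ‖(w : ℂ) ^ (c + (p.1 + p.2 : ℕ) - 1) * (1 - (w : ℂ)) ^ (σ + a' - c - 1)‖ := by
  obtain ⟨C, hC0, hC⟩ := exists_norm_pfaffCoeff_le a a' b b' hc
  obtain ⟨D, hD0, hD⟩ := exists_integral_norm_beta_le hc h1
  -- With `η = Re (σ + b' - c)`, the total exponent `-(η + Re a')` of `m + n` is split as
  -- `-(η - ε)`, given to `m`, and `-(Re a' + ε)`, given to `n`; both sums then converge.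
  obtain ⟨ε, hε0, hε⟩ := exists_between (lt_min h2 h3)
  obtain ⟨hε1, hε2⟩ := lt_min_iff.1 hε
  have hs := ((summable_rpow_add_one (p := -1 - (σ - a - b).re + ε) (by linarith)).mul_of_nonneg
    (summable_rpow_add_one (p := -1 - ε) (by linarith)) (fun _ => by positivity)
    (fun _ => by positivity)).mul_left (C * D)
  refine Summable.of_nonneg_of_le (fun p => by positivity) (fun ⟨m, n⟩ => ?_) hs
  have hsplit : ((m : ℝ) + n + 1) ^ (-b'.re) * ((m : ℝ) + n + 1) ^ (-(σ + a' - c).re) ≤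
      ((m : ℝ) + 1) ^ (-((σ + b' - c).re - ε)) * ((n : ℝ) + 1) ^ (-(a'.re + ε)) := by
    rw [← Real.rpow_add (by positivity), show -b'.re + -(σ + a' - c).re =
      -((σ + b' - c).re - ε) + -(a'.re + ε) by
        simp only [Complex.sub_re, Complex.add_re]; ring, Real.rpow_add (by positivity)]
    have hm : (0 : ℝ) ≤ m := Nat.cast_nonneg m
    have hn : (0 : ℝ) ≤ n := Nat.cast_nonneg n
    exact mul_le_mul (Real.rpow_le_rpow_of_nonpos (by linarith) (by linarith) (by linarith))
      (Real.rpow_le_rpow_of_nonpos (by linarith) (by linarith) (by linarith))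
      (by positivity) (by positivity)
  have hDN := hD (m + n)
  push_cast at hDN ⊢
  calc _ ≤ C * (((m : ℝ) + 1) ^ ((a + b - c + b').re - 1) * ((n : ℝ) + 1) ^ (a'.re - 1) *
        ((m : ℝ) + n + 1) ^ (-b'.re)) * (D * ((m : ℝ) + n + 1) ^ (-(σ + a' - c).re)) := by
        gcongr
        exact hC (m, n)
    _ = C * D * (((m : ℝ) + 1) ^ ((a + b - c + b').re - 1) * ((n : ℝ) + 1) ^ (a'.re - 1) *
        (((m : ℝ) + n + 1) ^ (-b'.re) * ((m : ℝ) + n + 1) ^ (-(σ + a' - c).re))) := by ring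
    _ ≤ C * D * (((m : ℝ) + 1) ^ ((a + b - c + b').re - 1) * ((n : ℝ) + 1) ^ (a'.re - 1) *
        (((m : ℝ) + 1) ^ (-((σ + b' - c).re - ε)) * ((n : ℝ) + 1) ^ (-(a'.re + ε)))) := by
        gcongr
    _ = C * D * ((((m : ℝ) + 1) ^ ((a + b - c + b').re - 1) *
        ((m : ℝ) + 1) ^ (-((σ + b' - c).re - ε))) *
        (((n : ℝ) + 1) ^ (a'.re - 1) * ((n : ℝ) + 1) ^ (-(a'.re + ε)))) := by ring
    _ = _ := by
      rw [← Real.rpow_add (by positivity), ← Real.rpow_add (by positivity)]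
      simp only [Complex.sub_re, Complex.add_re]
      ring_nf

lemma integral_unitIntegrand_of_re_pos {a a' b b' c σ : ℂ} (hc : 0 < c.re)
    (ha' : 0 < a'.re) (h1 : 0 < (σ + a' - c).re) (h2 : 0 < (σ + b' - c).re)
    (h3 : 0 < (σ - a - b).re) :
    IntegrableOn (unitIntegrand a a' b b' c σ) (Ioo 0 1) ∧
      ∫ w in Ioo 0 1, unitIntegrand a a' b b' c σ w = unitValue a a' b b' c σ := by
  let F : ℕ × ℕ → ℝ → ℂ := fun p w => pfaffCoeff a a' b b' c p *
    ((w : ℂ) ^ (c + (p.1 + p.2 : ℕ) - 1) * (1 - (w : ℂ)) ^ (σ + a' - c - 1))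
  have hF : ∀ p, IntegrableOn (F p) (Ioo 0 1) := fun p =>
    (integrableOn_beta (add_natCast_re_pos hc _) h1).const_mul _
  have hFsum : Summable fun p => ∫ w in Ioo 0 1, ‖F p w‖ := by
    simp only [F, norm_mul (pfaffCoeff _ _ _ _ _ _), integral_const_mul]
    exact summable_norm_pfaffCoeff_mul_integral hc ha' h1 h2 h3
  have hFeq : ∀ w ∈ Ioo (0 : ℝ) 1, ∀ p, F p w =
      (w : ℂ) ^ (c - 1) * (1 - (w : ℂ)) ^ (σ - c - 1) * (1 - (w : ℂ)) ^ a' *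
        (pfaffCoeff a a' b b' c p * (w : ℂ) ^ (p.1 + p.2)) := by
    intro w hw p
    have hw0 : (w : ℂ) ≠ 0 := by exact_mod_cast hw.1.ne'
    have hw1 : (1 - (w : ℂ)) ≠ 0 := one_sub_ofReal_ne_zero hw.2
    simp only [F]
    rw [show c + ((p.1 + p.2 : ℕ) : ℂ) - 1 = (c - 1) + ((p.1 + p.2 : ℕ) : ℂ) by ring,
      show σ + a' - c - 1 = (σ - c - 1) + a' by ring, Complex.cpow_add _ _ hw0,
      Complex.cpow_add _ _ hw1, Complex.cpow_natCast]
    ring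
  have hpt : ∀ w ∈ Ioo (0 : ℝ) 1, HasSum (fun p => F p w) (unitIntegrand a a' b b' c σ w) := by
    intro w hw
    simp only [hFeq w hw, unitIntegrand]
    rw [appellF3_eq_tsum a a' b b' hc hw.1 hw.2, ← mul_assoc]
    exact (summable_pfaffCoeff_mul_pow a a' b b' hc hw.1 hw.2).hasSum.mul_left _
  have hEq : EqOn (fun w => ∑' p, F p w) (unitIntegrand a a' b b' c σ) (Ioo 0 1) :=
    fun w hw => (hpt w hw).tsum_eq
  constructor
  · refine IntegrableOn.congr_fun ?_ hEq measurableSet_Ioo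
    exact integrable_tsum_of_summable_integral_norm hF hFsum
      ((ae_restrict_iff' measurableSet_Ioo).2 (Eventually.of_forall fun w hw =>
        (hpt w hw).summable))
  · rw [← setIntegral_congr_fun measurableSet_Ioo hEq]
    have hs := hasSum_integral_of_summable_integral_norm hF hFsum
    rw [← hs.tsum_eq, hs.summable.tsum_prod]
    have hterm : ∀ m n : ℕ, ∫ w in Ioo 0 1, F (m, n) w =
        Complex.Gamma c * Complex.Gamma (σ + a' - c) * (poch a m * poch b m / m.factorial) *
          gaussTerm a' (c + m - b') (σ + a' + m) n := by
      intro m n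
      simp only [F, integral_const_mul]
      rw [integral_beta (add_natCast_re_pos hc _) h1, Gamma_add_natCast hc, poch_add]
      simp only [pfaffCoeff, hypCoeff, gaussTerm]
      rw [show c + ((m + n : ℕ) : ℂ) + (σ + a' - c) = σ + a' + m + n by push_cast; ring]
      have := poch_ne_zero hc m
      have := poch_ne_zero (add_natCast_re_pos hc m) n
      have h3 : (m.factorial : ℂ) ≠ 0 := by exact_mod_cast m.factorial_ne_zero
      have h4 : (n.factorial : ℂ) ≠ 0 := by exact_mod_cast n.factorial_ne_zero
      generalize (Complex.Gamma (σ + a' + m + n))⁻¹ = X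
      field_simp
    have hrow : ∀ m : ℕ, ∑' n, ∫ w in Ioo 0 1, F (m, n) w =
        Complex.Gamma c * Complex.Gamma (σ + a' - c) * Complex.Gamma (σ + b' - c) *
          (Complex.Gamma (σ + a' + b' - c))⁻¹ * gaussTerm a b σ m := by
      intro m
      simp_rw [hterm]
      have e : σ + a' + m - a' - (c + m - b') = σ + b' - c := by ring
      rw [tsum_mul_left, tsum_gaussTerm (by rwa [e]), e,
        show σ + a' + m - a' = σ + m by ring,
        show σ + a' + m - (c + m - b') = σ + a' + b' - c by ring, gaussTerm]
      ring
    simp_rw [hrow]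
    rw [tsum_mul_left, tsum_gaussTerm h3, unitValue]

/-- The fractional integral of a power function, in the variable `w`. The parameter `a'` is raised
by contiguous relations until its real part is positive. -/
theorem integral_unitIntegrand {a a' b b' c σ : ℂ} (hc : 0 < c.re)
    (h1 : 0 < (σ + a' - c).re) (h2 : 0 < (σ + b' - c).re) (h3 : 0 < (σ - a - b).re) :
    IntegrableOn (unitIntegrand a a' b b' c σ) (Ioo 0 1) ∧
      ∫ w in Ioo 0 1, unitIntegrand a a' b b' c σ w = unitValue a a' b b' c σ := by
  obtain ⟨k, hk⟩ := exists_nat_gt (-a'.re)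
  induction k generalizing a' b' c with
  | zero => exact integral_unitIntegrand_of_re_pos hc (by simp at hk; exact hk) h1 h2 h3
  | succ k ih =>
    have hc0 := ne_zero_of_re_pos hc
    have hk' : -(a' + 1).re < k := by push_cast at hk; simp; linarith
    obtain ⟨i1, v1⟩ := ih (a' := a' + 1) (b' := b') (c := c) hc
      (by simp only [Complex.sub_re, Complex.add_re, Complex.one_re] at h1 ⊢; linarith) h2 hk'
    obtain ⟨i2, v2⟩ := ih (a' := a' + 1) (b' := b' + 1) (c := c + 1) (by simp; linarith)
      (by rwa [show σ + (a' + 1) - (c + 1) = σ + a' - c by ring])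
      (by rwa [show σ + (b' + 1) - (c + 1) = σ + b' - c by ring]) hk'
    have hEq : EqOn (fun w => unitIntegrand a (a' + 1) b b' c σ w +
        b' / c * unitIntegrand a (a' + 1) b (b' + 1) (c + 1) σ w)
        (unitIntegrand a a' b b' c σ) (Ioo 0 1) := by
      intro w hw
      have hw0 : (w : ℂ) ≠ 0 := by exact_mod_cast hw.1.ne'
      have hw1 : (1 - (w : ℂ)) ≠ 0 := one_sub_ofReal_ne_zero hw.2
      simp only [unitIntegrand]
      rw [appellF3_contiguous a a' b b' hc hw.1 hw.2, show c + 1 - 1 = (c - 1) + 1 by ring,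
        show σ - c - 1 = (σ - (c + 1) - 1) + 1 by ring, Complex.cpow_add _ 1 hw0,
        Complex.cpow_add _ 1 hw1, Complex.cpow_one, Complex.cpow_one]
      field_simp
    refine ⟨(i1.add (i2.const_mul _)).congr_fun hEq measurableSet_Ioo, ?_⟩
    rw [← setIntegral_congr_fun measurableSet_Ioo hEq, integral_add i1 (i2.const_mul _),
      integral_const_mul, v1, v2]
    simp only [unitValue]
    rw [show σ + (a' + 1) - (c + 1) = σ + a' - c by ring,
      show σ + (b' + 1) - (c + 1) = σ + b' - c by ring,
      show σ + (a' + 1) + (b' + 1) - (c + 1) = σ + a' + b' - c + 1 by ring,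
      show σ + (a' + 1) + b' - c = σ + a' + b' - c + 1 by ring,
      show σ + (a' + 1) - c = σ + a' - c + 1 by ring, Complex.Gamma_add_one _ hc0,
      Complex.Gamma_add_one _ (ne_zero_of_re_pos h1), inv_Gamma_eq (σ + a' + b' - c)]
    field_simp
    ring

/-! ### Fractional integrals of powers and of the cosine -/

lemma ofReal_inv_cpow {y : ℝ} (hy : 0 < y) (r : ℂ) : ((y⁻¹ : ℝ) : ℂ) ^ r = (y : ℂ) ^ (-r) := by
  rw [Complex.ofReal_inv, Complex.inv_cpow, Complex.cpow_neg]
  rw [Complex.arg_ofReal_of_nonneg hy.le]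
  exact Real.pi_ne_zero.symm

lemma image_div_one_sub {x : ℝ} (hx : 0 < x) :
    (fun w : ℝ => x * (1 - w)⁻¹) '' Ioo 0 1 = Ioi x := by
  ext t
  simp only [mem_image, mem_Ioo, mem_Ioi]
  constructor
  · rintro ⟨w, ⟨h0, h1⟩, rfl⟩
    rw [← div_eq_mul_inv, lt_div_iff₀ (by linarith)]
    nlinarith
  · intro ht
    have ht0 : 0 < t := hx.trans ht
    refine ⟨1 - x / t, ⟨?_, ?_⟩, ?_⟩
    · rw [sub_pos, div_lt_one ht0]; exact ht
    · have := div_pos hx ht0; linarith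
    · rw [sub_sub_cancel, inv_div]
      field_simp

/-- The substitution `t = x / (1 - w)` in the fractional integral of a power function. -/
lemma deriv_smul_rightIntegrand (α α' β β' γ ρ : ℂ) {x : ℝ} (hx : 0 < x) {w : ℝ}
    (hw : w ∈ Ioo (0 : ℝ) 1) :
    |x * ((1 - w) ^ 2)⁻¹| • rightIntegrand α α' β β' γ (fun t => (t : ℂ) ^ ρ) x (x * (1 - w)⁻¹) =
      (x : ℂ) ^ (γ - α + ρ) * unitIntegrand α α' β β' γ (α - ρ) w := by
  obtain ⟨h0, h1⟩ := hw
  have hy : 0 < 1 - w := by linarith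
  have hyc : ((1 - w : ℝ) : ℂ) ≠ 0 := by exact_mod_cast hy.ne'
  have hxc : (x : ℂ) ≠ 0 := by exact_mod_cast hx.ne'
  have e1 : x * (1 - w)⁻¹ - x = x * w * (1 - w)⁻¹ := by field_simp; ring
  have e2 : (1 : ℂ) - (x : ℂ) / ((x * (1 - w)⁻¹ : ℝ) : ℂ) = w := by
    rw [← Complex.ofReal_div, ← Complex.ofReal_one, ← Complex.ofReal_sub]
    congr 1
    field_simp; ring
  have e3 : (1 : ℂ) - ((x * (1 - w)⁻¹ : ℝ) : ℂ) / (x : ℂ) = -(w : ℂ) / (1 - w) := by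
    rw [← Complex.ofReal_one, ← Complex.ofReal_div, ← Complex.ofReal_sub, ← Complex.ofReal_sub,
      ← Complex.ofReal_neg, ← Complex.ofReal_div]
    congr 1
    field_simp; ring
  rw [rightIntegrand, unitIntegrand, e1, e2, e3, abs_of_pos (by positivity), Complex.real_smul]
  simp only [Complex.ofReal_mul x, Complex.ofReal_mul (x * w)]
  rw [← Complex.ofReal_mul x w,
    Complex.mul_cpow_ofReal_nonneg (by positivity) (by positivity),
    Complex.mul_cpow_ofReal_nonneg hx.le (by positivity),
    Complex.mul_cpow_ofReal_nonneg hx.le (by positivity), Complex.ofReal_mul x w,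
    Complex.mul_cpow_ofReal_nonneg hx.le h0.le, ofReal_inv_cpow hy, ofReal_inv_cpow hy,
    ofReal_inv_cpow hy, ← Complex.ofReal_one, ← Complex.ofReal_sub]
  have p1 : (x : ℂ) ^ (γ - α + ρ) = x * (x : ℂ) ^ (γ - 1) * (x : ℂ) ^ (-α) * (x : ℂ) ^ ρ := by
    rw [show γ - α + ρ = 1 + (γ - 1) + -α + ρ by ring, Complex.cpow_add _ _ hxc,
      Complex.cpow_add _ _ hxc, Complex.cpow_add _ _ hxc, Complex.cpow_one]
  have p2 : ((1 - w : ℝ) : ℂ) ^ (α - ρ - γ - 1) = ((((1 - w) ^ 2)⁻¹ : ℝ) : ℂ) *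
      ((1 - w : ℝ) : ℂ) ^ (-(γ - 1)) * ((1 - w : ℝ) : ℂ) ^ (- -α) *
      ((1 - w : ℝ) : ℂ) ^ (-ρ) := by
    rw [show α - ρ - γ - 1 = -((2 : ℕ) : ℂ) + -(γ - 1) + - -α + -ρ by push_cast; ring,
      Complex.cpow_add _ _ hyc, Complex.cpow_add _ _ hyc, Complex.cpow_add _ _ hyc,
      Complex.cpow_neg _ ((2 : ℕ) : ℂ), Complex.cpow_natCast, Complex.ofReal_inv,
      Complex.ofReal_pow]
  simp only [Complex.ofReal_one] at p2 ⊢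
  rw [p1, p2]
  ring

/-- The quotient of Gamma functions in the fractional integral of the power `t ^ ρ`. -/
def powerValue (α α' β β' γ ρ : ℂ) : ℂ :=
  Complex.Gamma (-ρ - γ + α + α') * Complex.Gamma (-ρ + α + β' - γ) * Complex.Gamma (-ρ - β) /
    (Complex.Gamma (-ρ) * Complex.Gamma (-ρ - γ + α + α' + β') * Complex.Gamma (-ρ + α - β))

/-- The right-sided fractional integral of a power function. -/
theorem rightFracInt_cpow {α α' β β' γ ρ : ℂ} {x : ℝ} (hx : 0 < x) (hγ : 0 < γ.re)
    (hρ : ρ.re < min (-β).re (min (α + α' - γ).re (α + β' - γ).re)) :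
    IntegrableOn (rightIntegrand α α' β β' γ (fun t => (t : ℂ) ^ ρ) x) (Ioi x) ∧
      rightFracInt α α' β β' γ (fun t => (t : ℂ) ^ ρ) x =
        (x : ℂ) ^ (ρ - α - α' + γ) * powerValue α α' β β' γ ρ := by
  simp only [lt_min_iff, Complex.neg_re, Complex.sub_re, Complex.add_re] at hρ
  obtain ⟨h1, h2, h3⟩ := hρ
  have hxc : (x : ℂ) ≠ 0 := by exact_mod_cast hx.ne'
  obtain ⟨hi, hv⟩ := integral_unitIntegrand (a := α) (a' := α') (b := β) (b' := β') (c := γ)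
    (σ := α - ρ) hγ (by simp only [Complex.sub_re, Complex.add_re]; linarith)
    (by simp only [Complex.sub_re, Complex.add_re]; linarith)
    (by simp only [Complex.sub_re]; linarith)
  have hderiv : ∀ w ∈ Ioo (0 : ℝ) 1, HasDerivWithinAt (fun w : ℝ => x * (1 - w)⁻¹)
      (x * ((1 - w) ^ 2)⁻¹) (Ioo 0 1) w := by
    intro w hw
    have hy : 1 - w ≠ 0 := by linarith [hw.2]
    have := (((hasDerivAt_id w).const_sub 1).inv hy).const_mul x
    simpa using this.hasDerivWithinAt
  have hinj : InjOn (fun w : ℝ => x * (1 - w)⁻¹) (Ioo 0 1) := by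
    intro w _ v _ h
    simpa [hx.ne'] using h
  have hEq : EqOn (fun w => (x : ℂ) ^ (γ - α + ρ) * unitIntegrand α α' β β' γ (α - ρ) w)
      (fun w => |x * ((1 - w) ^ 2)⁻¹| •
        rightIntegrand α α' β β' γ (fun t => (t : ℂ) ^ ρ) x (x * (1 - w)⁻¹)) (Ioo 0 1) :=
    fun w hw => (deriv_smul_rightIntegrand α α' β β' γ ρ hx hw).symm
  constructor
  · rw [← image_div_one_sub hx,
      integrableOn_image_iff_integrableOn_abs_deriv_smul measurableSet_Ioo hderiv hinj]
    exact IntegrableOn.congr_fun (hi.const_mul _) hEq measurableSet_Ioo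
  · rw [rightFracInt, ← image_div_one_sub hx,
      integral_image_eq_integral_abs_deriv_smul measurableSet_Ioo hderiv hinj,
      ← setIntegral_congr_fun measurableSet_Ioo hEq, integral_const_mul, hv, unitValue, powerValue,
      show ρ - α - α' + γ = -α' + (γ - α + ρ) by ring,
      Complex.cpow_add (-α') (γ - α + ρ) hxc, show α - ρ + α' - γ = -ρ - γ + α + α' by ring,
      show α - ρ + β' - γ = -ρ + α + β' - γ by ring,
      show α - ρ + α' + β' - γ = -ρ - γ + α + α' + β' by ring,
      show α - ρ - α - β = -ρ - β by ring, show α - ρ - α = -ρ by ring,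
      show α - ρ - β = -ρ + α - β by ring]
    have := Complex.Gamma_ne_zero_of_re_pos hγ
    rw [div_eq_mul_inv (_ * _ * _) (_ * _ * _), mul_inv, mul_inv]
    field_simp

lemma re_sub_two_mul_natCast_le (ρ : ℂ) (k : ℕ) : (ρ - 2 * k).re ≤ ρ.re := by
  simp

/-- Legendre's duplication formula at `k + 1 / 2`. -/
lemma four_pow_mul_factorial_mul_Gamma (k : ℕ) :
    (4 : ℂ) ^ k * (k.factorial : ℂ) * Complex.Gamma (1 / 2 + k) =
      ((2 * k).factorial : ℂ) * (Real.sqrt Real.pi : ℂ) := by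
  have h := Complex.Gamma_mul_Gamma_add_half (1 / 2 + k)
  rw [show (1 / 2 + (k : ℂ)) + 1 / 2 = k + 1 by ring, Complex.Gamma_nat_eq_factorial,
    show 2 * (1 / 2 + (k : ℂ)) = ((2 * k : ℕ) : ℂ) + 1 by push_cast; ring,
    Complex.Gamma_nat_eq_factorial,
    show (1 : ℂ) - (((2 * k : ℕ) : ℂ) + 1) = -((2 * k : ℕ) : ℂ) by ring,
    Complex.cpow_neg, Complex.cpow_natCast, pow_mul] at h
  rw [mul_assoc, mul_comm (k.factorial : ℂ), h]
  norm_num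
  field_simp

/-- The terms of the Wright series come from the Taylor series of the cosine. -/
lemma cos_coeff_mul_powerValue (α α' β β' γ ρ c : ℂ) {x : ℝ} (hx : 0 < x) (k : ℕ) :
    (-1) ^ k * c ^ (2 * k) / ((2 * k).factorial : ℂ) *
        ((x : ℂ) ^ (ρ - 2 * k - α - α' + γ) * powerValue α α' β β' γ (ρ - 2 * k)) =
      (Real.sqrt Real.pi : ℂ) * (x : ℂ) ^ (ρ - α - α' + γ) *
        wrightTerm (topParams α α' β β' γ ρ) (bottomParams α α' β β' γ ρ)
          (-(c ^ 2 / (4 * (x : ℂ) ^ 2))) k := by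
  have hxc : (x : ℂ) ≠ 0 := by exact_mod_cast hx.ne'
  have hG : Complex.Gamma (1 / 2 + k) ≠ 0 :=
    Complex.Gamma_ne_zero_of_re_pos (add_natCast_re_pos (by norm_num) k)
  have hk : (k.factorial : ℂ) ≠ 0 := by exact_mod_cast k.factorial_ne_zero
  have h2k : ((2 * k).factorial : ℂ) ≠ 0 := by exact_mod_cast (2 * k).factorial_ne_zero
  have e1 : (x : ℂ) ^ (ρ - 2 * k - α - α' + γ) =
      (x : ℂ) ^ (ρ - α - α' + γ) / (x : ℂ) ^ (2 * k) := by
    rw [show ρ - 2 * k - α - α' + γ = (ρ - α - α' + γ) - ((2 * k : ℕ) : ℂ) by push_cast; ring,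
      Complex.cpow_sub _ _ hxc, Complex.cpow_natCast]
  have e2 : wrightTerm (topParams α α' β β' γ ρ) (bottomParams α α' β β' γ ρ)
      (-(c ^ 2 / (4 * (x : ℂ) ^ 2))) k = powerValue α α' β β' γ (ρ - 2 * k) *
        (Complex.Gamma (1 / 2 + k))⁻¹ * ((-(c ^ 2 / (4 * (x : ℂ) ^ 2))) ^ k / k.factorial) := by
    simp only [wrightTerm, topParams, bottomParams, powerValue, Fin.prod_univ_succ,
      Fin.prod_univ_zero, Matrix.cons_val_zero, Matrix.cons_val_succ, Complex.ofReal_ofNat,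
      Complex.ofReal_one, one_mul, mul_one]
    rw [show -(ρ - 2 * k) - γ + α + α' + β' = -ρ - γ + α + α' + β' + 2 * k by ring,
      show -(ρ - 2 * k) - γ + α + α' = -ρ - γ + α + α' + 2 * k by ring,
      show -(ρ - 2 * k) + α + β' - γ = -ρ + α + β' - γ + 2 * k by ring,
      show -(ρ - 2 * k) - β = -ρ - β + 2 * k by ring,
      show -(ρ - 2 * k) + α - β = -ρ + α - β + 2 * k by ring,
      show -(ρ - 2 * k) = -ρ + 2 * k by ring]
    simp only [div_eq_mul_inv, mul_inv]
    ring
  have h4 := four_pow_mul_factorial_mul_Gamma k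
  rw [e1, e2, neg_pow (c ^ 2 / _), div_pow, mul_pow, ← pow_mul, ← pow_mul]
  generalize powerValue α α' β β' γ (ρ - 2 * k) = X
  generalize Complex.Gamma (1 / 2 + k) = G at h4 hG ⊢
  have h40 : (4 : ℂ) ^ k ≠ 0 := pow_ne_zero _ (by norm_num)
  field_simp
  linear_combination c ^ (2 * k) * (x : ℂ) ^ (ρ - α - α' + γ) * X * h4

lemma norm_cos_term_le {c : ℂ} {x t : ℝ} (hx : 0 < x) (ht : x < t) (k : ℕ) :
    ‖(-1) ^ k * (c / (t : ℂ)) ^ (2 * k) / ((2 * k).factorial : ℂ)‖ ≤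
      (‖c‖ / x) ^ (2 * k) / ((2 * k).factorial : ℝ) := by
  have ht0 : 0 < t := hx.trans ht
  rw [norm_div, norm_mul, norm_pow, norm_pow, norm_neg, norm_one, one_pow, one_mul, norm_div,
    Complex.norm_natCast, Complex.norm_real, Real.norm_of_nonneg ht0.le]
  gcongr

/-- The fractional integral of `t ^ ρ cos (c / t)` is obtained by integrating the Taylor series of
the cosine term by term. -/
theorem rightFracInt_cos {α α' β β' γ ρ : ℂ} (c : ℂ) {x : ℝ} (hx : 0 < x) (hγ : 0 < γ.re)
    (hρ : ρ.re < min (-β).re (min (α + α' - γ).re (α + β' - γ).re)) :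
    IntegrableOn (rightIntegrand α α' β β' γ (fun t => (t : ℂ) ^ ρ * Complex.cos (c / (t : ℂ))) x)
        (Ioi x) ∧
      HasSum (fun k => (Real.sqrt Real.pi : ℂ) * (x : ℂ) ^ (ρ - α - α' + γ) *
        wrightTerm (topParams α α' β β' γ ρ) (bottomParams α α' β β' γ ρ)
          (-(c ^ 2 / (4 * (x : ℂ) ^ 2))) k)
        (rightFracInt α α' β β' γ (fun t => (t : ℂ) ^ ρ * Complex.cos (c / (t : ℂ))) x) := by
  let F : ℕ → ℝ → ℂ := fun k t => (-1) ^ k * c ^ (2 * k) / ((2 * k).factorial : ℂ) *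
    rightIntegrand α α' β β' γ (fun t => (t : ℂ) ^ (ρ - 2 * k)) x t
  have hpow := fun k : ℕ => rightFracInt_cpow (α := α) (α' := α') (β := β) (β' := β')
    hx hγ ((re_sub_two_mul_natCast_le ρ k).trans_lt hρ)
  have h0 := (rightFracInt_cpow (α := α) (α' := α') (β := β) (β' := β') hx hγ hρ).1
  have hFi : ∀ k, IntegrableOn (F k) (Ioi x) := fun k => (hpow k).1.const_mul _
  have hFeq : ∀ t ∈ Ioi x, ∀ k, F k t = rightIntegrand α α' β β' γ (fun t => (t : ℂ) ^ ρ) x t *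
      ((-1) ^ k * (c / (t : ℂ)) ^ (2 * k) / ((2 * k).factorial : ℂ)) := by
    intro t ht k
    have ht0 : (t : ℂ) ≠ 0 := by exact_mod_cast (hx.trans ht).ne'
    simp only [F, rightIntegrand]
    rw [show ρ - 2 * (k : ℂ) = ρ - ((2 * k : ℕ) : ℂ) by push_cast; ring, Complex.cpow_sub _ _ ht0,
      Complex.cpow_natCast, div_pow]
    ring
  have hFsum : Summable fun k => ∫ t in Ioi x, ‖F k t‖ := by
    refine Summable.of_nonneg_of_le (fun k => integral_nonneg fun _ => norm_nonneg _) (fun k => ?_)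
      ((Real.hasSum_cosh (‖c‖ / x)).summable.mul_right
        (∫ t in Ioi x, ‖rightIntegrand α α' β β' γ (fun t => (t : ℂ) ^ ρ) x t‖))
    rw [← integral_const_mul]
    refine setIntegral_mono_on (hFi k).norm (h0.norm.const_mul _) measurableSet_Ioi fun t ht => ?_
    rw [hFeq t ht, norm_mul, mul_comm]
    gcongr
    exact norm_cos_term_le hx ht k
  have hpt : ∀ t ∈ Ioi x, HasSum (fun k => F k t)
      (rightIntegrand α α' β β' γ (fun t => (t : ℂ) ^ ρ * Complex.cos (c / (t : ℂ))) x t) := by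
    intro t ht
    simp only [hFeq t ht]
    have := (Complex.hasSum_cos (c / (t : ℂ))).mul_left
      (rightIntegrand α α' β β' γ (fun t => (t : ℂ) ^ ρ) x t)
    rwa [show rightIntegrand α α' β β' γ (fun t => (t : ℂ) ^ ρ) x t * Complex.cos (c / (t : ℂ)) =
      rightIntegrand α α' β β' γ (fun t => (t : ℂ) ^ ρ * Complex.cos (c / (t : ℂ))) x t by
        simp only [rightIntegrand]; ring] at this
  have hEq : EqOn (fun t => ∑' k, F k t)
      (rightIntegrand α α' β β' γ (fun t => (t : ℂ) ^ ρ * Complex.cos (c / (t : ℂ))) x) (Ioi x) :=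
    fun t ht => (hpt t ht).tsum_eq
  constructor
  · refine IntegrableOn.congr_fun ?_ hEq measurableSet_Ioi
    exact integrable_tsum_of_summable_integral_norm hFi hFsum
      ((ae_restrict_iff' measurableSet_Ioi).2 (Eventually.of_forall fun t ht =>
        (hpt t ht).summable))
  · have hs := (hasSum_integral_of_summable_integral_norm hFi hFsum).mul_left
      ((x : ℂ) ^ (-α') / Complex.Gamma γ)
    rw [setIntegral_congr_fun measurableSet_Ioi hEq] at hs
    rw [rightFracInt]
    refine hs.congr_fun fun k => ?_
    rw [← cos_coeff_mul_powerValue α α' β β' γ ρ c hx k, ← (hpow k).2, rightFracInt]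
    simp only [F, integral_const_mul]
    ring

lemma rightFracInt_cos_eq_wrightPsi {α α' β β' γ ρ : ℂ} (c : ℂ) {x : ℝ} (hx : 0 < x)
    (hγ : 0 < γ.re) (hρ : ρ.re < min (-β).re (min (α + α' - γ).re (α + β' - γ).re)) :
    IntegrableOn
        (rightIntegrand α α' β β' γ (fun t => (t : ℂ) ^ ρ * Complex.cos (c / (t : ℂ))) x)
        (Ioi x) ∧
      Summable (wrightTerm (topParams α α' β β' γ ρ) (bottomParams α α' β β' γ ρ)
        (-(c ^ 2 / (4 * (x : ℂ) ^ 2)))) ∧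
      rightFracInt α α' β β' γ (fun t => (t : ℂ) ^ ρ * Complex.cos (c / (t : ℂ))) x =
        (Real.sqrt Real.pi : ℂ) * (x : ℂ) ^ (ρ - α - α' + γ) *
          wrightPsi (topParams α α' β β' γ ρ) (bottomParams α α' β β' γ ρ)
            (-(c ^ 2 / (4 * (x : ℂ) ^ 2))) := by
  obtain ⟨hi, hs⟩ := rightFracInt_cos (α := α) (α' := α') (β := β) (β' := β') c hx hγ hρ
  have hne : (Real.sqrt Real.pi : ℂ) * (x : ℂ) ^ (ρ - α - α' + γ) ≠ 0 := by
    refine mul_ne_zero ?_ ?_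
    · exact_mod_cast (Real.sqrt_pos.2 Real.pi_pos).ne'
    · rw [Complex.cpow_ne_zero_iff]
      exact Or.inl (by exact_mod_cast hx.ne')
  refine ⟨hi, (summable_mul_left_iff hne).1 hs.summable, ?_⟩
  rw [wrightPsi, ← tsum_mul_left, hs.tsum_eq]

end MSM

end

theorem mainTheorem6 (α α' β β' γ ρ c : ℂ) (x : ℝ) (hx : 0 < x) (hγ : 0 < γ.re)
    (hρ : ρ.re < min (-β).re (min (α + α' - γ).re (α + β' - γ).re)) :
    (IntegrableOn
        (MSM.rightIntegrand α α' β β' γ (fun t => (t : ℂ) ^ ρ * Complex.cos (c / (t : ℂ))) x)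
        (Ioi x) ∧
      Summable (MSM.wrightTerm (MSM.topParams α α' β β' γ ρ) (MSM.bottomParams α α' β β' γ ρ)
        (-(c ^ 2 / (4 * (x : ℂ) ^ 2)))) ∧
      MSM.rightFracInt α α' β β' γ (fun t => (t : ℂ) ^ ρ * Complex.cos (c / (t : ℂ))) x =
        (Real.sqrt Real.pi : ℂ) * (x : ℂ) ^ (ρ - α - α' + γ) *
          MSM.wrightPsi (MSM.topParams α α' β β' γ ρ) (MSM.bottomParams α α' β β' γ ρ)
            (-(c ^ 2 / (4 * (x : ℂ) ^ 2)))) ∧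
    (IntegrableOn
        (MSM.rightIntegrand α α' β β' γ (fun t => (t : ℂ) ^ ρ * Complex.cosh (c / (t : ℂ))) x)
        (Ioi x) ∧
      Summable (MSM.wrightTerm (MSM.topParams α α' β β' γ ρ) (MSM.bottomParams α α' β β' γ ρ)
        (c ^ 2 / (4 * (x : ℂ) ^ 2))) ∧
      MSM.rightFracInt α α' β β' γ (fun t => (t : ℂ) ^ ρ * Complex.cosh (c / (t : ℂ))) x =
        (Real.sqrt Real.pi : ℂ) * (x : ℂ) ^ (ρ - α - α' + γ) *
          MSM.wrightPsi (MSM.topParams α α' β β' γ ρ) (MSM.bottomParams α α' β β' γ ρ)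
            (c ^ 2 / (4 * (x : ℂ) ^ 2))) := by
  refine ⟨MSM.rightFracInt_cos_eq_wrightPsi c hx hγ hρ, ?_⟩
  -- `cosh (c / t) = cos (c i / t)`
  have h := MSM.rightFracInt_cos_eq_wrightPsi (c * Complex.I) hx hγ hρ
  have e1 : ∀ t : ℝ, Complex.cos (c * Complex.I / t) = Complex.cosh (c / t) := fun t => by
    rw [mul_div_right_comm, Complex.cos_mul_I]
  have e2 : -((c * Complex.I) ^ 2 / (4 * (x : ℂ) ^ 2)) = c ^ 2 / (4 * (x : ℂ) ^ 2) := by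
    rw [mul_pow, Complex.I_sq]; ring
  simpa only [e1, e2] using h
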